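/- Let $d\in\{1,2\}$, and let $\mathcal R$ (red) and $\mathcal B$ (blue) be independent homogeneous Poisson processes of intensity $1$ on $\mathbb R^d$, with supports $[\mathcal R],[\mathcal B]$. Let $\mathcal M$ be a translation-invariant two-color matching scheme between $\mathcal R$ and $\mathcal B$. This means that $\mathcal M$ is a simple point process of unordered pairs $\{x,y\}\subset\mathbb R^d$, on the same probability space as $\mathcal R$ and $\mathcal B$ (not necessarily a deterministic function of them), such that: - almost surely the support $[\mathcal M]$ is the edge set of a perfect bipartite matching between $[\mathcal R]$ and $[\mathcal B]$, i.e. every edge joins a red point to a blue point and every red or blue point $x$ lies in exactly one edge $\{x,\mathcal M(x)\}\in[\mathcal M]$; - the joint law of $(\mathcal R,\mathcal B,\mathcal M)$ is invariant under all translations of $\mathbb R^d$. For $r\ge 0$ put $$F(r):=\mathbb E\,\#\big\{x\in[\mathcal R]\cap[0,1)^d:\ |x-\mathcal M(x)|\le r\big\},$$ where $|\cdot|$ is the Euclidean norm. Then $F$ is the distribution function of a probability measure on $[0,\infty)$, and every $[0,\infty)$-valued random variable $X$ with $\mathbb P^*(X\le r)=F(r)$ for all $r\ge0$ (the typical distance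 from a red point to its partner) satisfies $$\mathbb E^* X^{d/2}=\infty .$$ -/

import Mathlib

open MeasureTheory ProbabilityTheory
open scoped NNReal ENNReal

noncomputable section

namespace PoissonMatching

/-- Euclidean space of dimension `d`, with the Euclidean norm. -/
abbrev Space (d : ℕ) : Type := EuclideanSpace ℝ (Fin d)

/-- The half-open unit cube `[0,1)^d`. -/
def unitCube (d : ℕ) : Set (Space d) := {x | ∀ i, 0 ≤ x i ∧ x i < 1}

/-- The support of a simple point measure: the set of points of mass `1`. -/
def pointSet {α : Type*} [MeasurableSpace α] (m : Measure α) : Set α := {x | m {x} = 1}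

/-- `m` is a countable sum of unit masses at distinct points. -/
def IsSimplePointMeasure {α : Type*} [MeasurableSpace α] (m : Measure α) : Prop :=
  (pointSet m).Countable ∧ m = Measure.sum (fun x : pointSet m => Measure.dirac (x : α))

/-- A simple point process on `ℝ^d`: a random measure which is almost surely a sum of unit masses
at distinct points, only finitely many of them in each bounded set. -/
structure IsSimplePointProcess {d : ℕ} {Ω : Type*} [MeasurableSpace Ω]
    (N : Ω → Measure (Space d)) (P : Measure Ω) : Prop where
  measurable : Measurable N
  simple : ∀ᵐ ω ∂P, IsSimplePointMeasure (N ω)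
  locallyFinite : ∀ᵐ ω ∂P, ∀ A : Set (Space d), Bornology.IsBounded A →
    (pointSet (N ω) ∩ A).Finite

/-- A homogeneous Poisson process on `ℝ^d` of intensity `c`: a simple point process such that the
number of points in a bounded Borel set `A` is Poisson distributed with mean `c` times the volume
of `A`, and the numbers of points in disjoint bounded Borel sets are independent. -/
structure IsPoissonProcess {d : ℕ} {Ω : Type*} [MeasurableSpace Ω]
    (c : ℝ≥0) (N : Ω → Measure (Space d)) (P : Measure Ω) : Prop where
  isSimplePointProcess : IsSimplePointProcess N P
  count_law : ∀ A : Set (Space d), MeasurableSet A → Bornology.IsBounded A →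
    P.map (fun ω => N ω A) =
      (poissonMeasure (c * (volume A).toNNReal)).map (fun n : ℕ => (n : ℝ≥0∞))
  indep : ∀ (k : ℕ) (A : Fin k → Set (Space d)), (∀ i, MeasurableSet (A i)) →
    (∀ i, Bornology.IsBounded (A i)) → Pairwise (fun i j => Disjoint (A i) (A j)) →
    iIndepFun (fun i ω => N ω (A i)) P

/-- `S` is the edge set of a perfect bipartite matching between `U` and `V`: a simple graph on the
vertex set `U ∪ V` in which all edges run from `U` to `V` and every vertex has degree `1`. -/
structure IsPerfectBipartiteMatching {α : Type*} (U V : Set α) (S : Set (Sym2 α)) : Prop where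
  loopless : ∀ e ∈ S, ¬ e.IsDiag
  bipartite : ∀ e ∈ S, ∃ x ∈ U, ∃ y ∈ V, e = s(x, y)
  degree_one : ∀ z ∈ U ∪ V, ∃! e, e ∈ S ∧ z ∈ e

/-- A two-color matching scheme between the red process `R` and the blue process `B`: a simple
point process `M` of unordered pairs of points, on the same probability space, whose support is
almost surely a perfect bipartite matching between the red and the blue points.
Unordered pairs carry the quotient σ-algebra under `(x, y) ↦ {x, y}`.
(Such an `M` is automatically locally finite when `R` and `B` are.) -/
structure IsTwoColorMatchingScheme {d : ℕ} {Ω : Type*} [MeasurableSpace Ω]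
    (R B : Ω → Measure (Space d)) (M : Ω → Measure (Sym2 (Space d))) (P : Measure Ω) : Prop where
  measurable : Measurable M
  simple : ∀ᵐ ω ∂P, IsSimplePointMeasure (M ω)
  matching : ∀ᵐ ω ∂P,
    IsPerfectBipartiteMatching (pointSet (R ω)) (pointSet (B ω)) (pointSet (M ω))

/-- The joint law of `(R, B, M)` is invariant under all translations of `ℝ^d`. -/
def IsTranslationInvariant {d : ℕ} {Ω : Type*} [MeasurableSpace Ω]
    (R B : Ω → Measure (Space d)) (M : Ω → Measure (Sym2 (Space d))) (P : Measure Ω) : Prop :=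
  ∀ v : Space d,
    IdentDistrib
      (fun ω => ((R ω).map (fun x => x + v), (B ω).map (fun x => x + v),
        (M ω).map (Sym2.map (fun x => x + v))))
      (fun ω => (R ω, B ω, M ω)) P P

/-- `F(r)`: the expected number of red points in the unit cube whose partner lies within
distance `r`. -/
def matchingDistribution {d : ℕ} {Ω : Type*} [MeasurableSpace Ω]
    (R : Ω → Measure (Space d)) (M : Ω → Measure (Sym2 (Space d))) (P : Measure Ω)
    (r : ℝ≥0) : ℝ≥0∞ :=
  ∫⁻ ω, (({x | x ∈ pointSet (R ω) ∩ unitCube d ∧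
    ∃ y, s(x, y) ∈ pointSet (M ω) ∧ ‖x - y‖ ≤ r}.encard : ℕ∞) : ℝ≥0∞) ∂P

end PoissonMatching

end

/-! Let `D` be the number of red points minus the number of blue points in the unit cube, regarded
as an element of `L¹` of the joint law. Integer translations act there by commuting linear
isometries `T v`. Suppose the typical distance had a finite moment of order `d/2`. The sum of the
translates of `D` over `n^d` lattice cubes would then be of size `o(n^(d/2))`. It is in fact at
least a constant times `n^(d/2)`, because it is a difference of two independent Poisson variables of
mean `n^d` (`IsPoissonVar.sqrt_mul_le_integral_abs_diff`, proved with characteristic functions).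

The matching enters through `hasSum_discrepancy`. With `F v` the number of edges from a red point of
cube `0` to a partner in cube `v`, `D` is the sum over `v` of `F v - T (-v) (F v)`. The finite
moment says that `|v i| ^ (d/2) * ‖F v‖` is summable in `v` for each coordinate `i`.

In dimension one the `v`-term, summed over `n` cubes, telescopes to norm at most `2 * min |v| n * ‖F
v‖`. Divided by `√n`, this is at most `2 * √|v| * ‖F v‖` and tends to zero for fixed `v`, so
dominated convergence gives `o(√n)` (`tendsto_sum_div_sqrt`).

In dimension two each edge is replaced by a lattice path, horizontal and then vertical. The first
moment makes the total flows `U` and `W` across unit sides converge in `L¹`, and `D = (U - T e U) +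
(W - T f W)`. Summed over a square of side `n`, the flux through opposite sides is a priori of order
`n`, the same order as the lower bound. The mean ergodic theorem improves this: averages of `U`
along `f` converge to a limit `L`. Averages of `D` along a line vanish, its line sums being only of
order `√n`, so `L` is fixed by `T e`. The leading fluxes through opposite sides therefore cancel,
leaving `o(n)` (`tendsto_flux`, `tendsto_inv_smul_sum`). -/

noncomputable section

open Filter Topology

namespace PoissonMatching

/-! ### Flow bounds for commuting isometries: coboundaries and flux cancellation. -/

section Isometric

variable {G X : Type*} [AddCommGroup G] [NormedAddCommGroup X] [NormedSpace ℝ X]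

/-- An action of an additive commutative group by linear isometries. -/
structure IsIsometricAction (T : G → X →ₗᵢ[ℝ] X) : Prop where
  zero : ∀ x, T 0 x = x
  add : ∀ v w x, T (v + w) x = T v (T w x)

namespace IsIsometricAction

variable {T : G → X →ₗᵢ[ℝ] X}

lemma comm (hT : IsIsometricAction T) (v w : G) (x : X) : T v (T w x) = T w (T v x) := by
  rw [← hT.add, ← hT.add, add_comm]

lemma sum_sub (hT : IsIsometricAction T) (e : G) (n : ℕ) (x : X) :
    ∑ k ∈ Finset.range n, T (k • e) (x - T e x) = x - T (n • e) x := by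
  induction n with
  | zero => simp [hT.zero]
  | succ n ih =>
    rw [Finset.sum_range_succ, ih, map_sub, ← hT.add, succ_nsmul]
    abel

/-- A jump of `n` steps is split into `n` unit steps. The witness collects the mass crossing one
unit step, which explains the factor `n` in its norm. -/
lemma exists_coboundary_nat (hT : IsIsometricAction T) (e : G) (n : ℕ) (x : X) :
    ∃ u, ‖u‖ ≤ n * ‖x‖ ∧ x - T (n • e) x = u - T e u := by
  refine ⟨∑ k ∈ Finset.range n, T (k • e) x, ?_, ?_⟩
  · refine (norm_sum_le _ _).trans ?_
    simp
  · rw [map_sum, ← Finset.sum_sub_distrib, ← hT.sum_sub]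
    refine Finset.sum_congr rfl fun k _ => ?_
    rw [map_sub, hT.comm]

/-- Displacement by a multiple of `e` is a coboundary for `e`, with control of the norm. -/
lemma exists_coboundary (hT : IsIsometricAction T) (e : G) (n : ℤ) (x : X) :
    ∃ u, ‖u‖ ≤ |(n : ℝ)| * ‖x‖ ∧ x - T (n • e) x = u - T e u := by
  obtain ⟨m, rfl | rfl⟩ := n.eq_nat_or_neg
  · obtain ⟨u, hu, h⟩ := hT.exists_coboundary_nat e m x
    exact ⟨u, by simpa using hu, by simpa using h⟩
  -- A backward jump from `x` is a forward jump from its endpoint, with the opposite sign; the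
  -- endpoint has the same norm as `x`.
  · obtain ⟨u, hu, h⟩ := hT.exists_coboundary_nat e m (T ((-(m : ℤ)) • e) x)
    refine ⟨-u, by simpa using hu, ?_⟩
    rw [← hT.add] at h
    simp only [neg_smul, natCast_zsmul, add_neg_cancel, hT.zero, map_neg] at h ⊢
    rw [← neg_sub, h]
    abel

/-- Only jumps crossing an end of the interval survive the cancellation. Telescoping the coboundary
gives `|k|` per end, and the triangle inequality gives the competing bound by `n`. -/
lemma norm_sum_sub_le (hT : IsIsometricAction T) (e : G) (n : ℕ) (k : ℤ) (x : X) :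
    ‖∑ i ∈ Finset.range n, T (i • e) (x - T (k • e) x)‖ ≤ 2 * min |(k : ℝ)| n * ‖x‖ := by
  obtain ⟨u, hu, h⟩ := hT.exists_coboundary e k x
  have h1 : ‖∑ i ∈ Finset.range n, T (i • e) (x - T (k • e) x)‖ ≤ 2 * |(k : ℝ)| * ‖x‖ := by
    rw [h, hT.sum_sub]
    refine (norm_sub_le _ _).trans ?_
    rw [LinearIsometry.norm_map]
    linarith
  have h2 : ‖∑ i ∈ Finset.range n, T (i • e) (x - T (k • e) x)‖ ≤ 2 * n * ‖x‖ := by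
    refine (norm_sum_le_of_le (Finset.range n) (n := fun _ => 2 * ‖x‖) fun i _ => ?_).trans ?_
    · rw [LinearIsometry.norm_map]
      refine (norm_sub_le _ _).trans ?_
      rw [LinearIsometry.norm_map]
      linarith
    · simp only [Finset.sum_const, Finset.card_range, nsmul_eq_mul]
      linarith
  rcases min_choice |(k : ℝ)| (n : ℝ) with h | h <;> rw [h] <;> assumption

/-- One-dimensional flow bound: a superposition of displacements with summable half moment
has partial sums of size `o(√n)`. -/
theorem tendsto_sum_div_sqrt (hT : IsIsometricAction T) {ι : Type*} (e : G) (F : ι → X) (a : ι → ℤ)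
    (hs : Summable fun v => |(a v : ℝ)| ^ (1 / 2 : ℝ) * ‖F v‖) (D : X)
    (hD : HasSum (fun v => F v - T (a v • e) (F v)) D) :
    Tendsto (fun n : ℕ => ‖∑ i ∈ Finset.range n, T (i • e) D‖ / √n) atTop (𝓝 0) := by
  have hS : ∀ n : ℕ, HasSum (fun v => ∑ i ∈ Finset.range n, T (i • e) (F v - T (a v • e) (F v)))
      (∑ i ∈ Finset.range n, T (i • e) D) := fun n =>
    hasSum_sum fun i _ => ((T (i • e)).toContinuousLinearMap.hasSum hD)
  -- A minimum is at most the geometric mean `√(|k| n)`; this is where the exponent one half comes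
  -- from.
  have hmin : ∀ (n : ℕ) (k : ℤ), min |(k : ℝ)| n / √n ≤ |(k : ℝ)| ^ (1 / 2 : ℝ) := by
    intro n k
    rw [← Real.sqrt_eq_rpow]
    rcases Nat.eq_zero_or_pos n with rfl | hn
    · simp
    · have hn' : (0 : ℝ) < n := by exact_mod_cast hn
      rw [div_le_iff₀ (Real.sqrt_pos.2 hn'), ← Real.sqrt_mul (abs_nonneg _)]
      refine Real.le_sqrt_of_sq_le ?_
      rw [sq]
      exact mul_le_mul (min_le_left _ _) (min_le_right _ _) (le_min (abs_nonneg _) hn'.le)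
        (abs_nonneg _)
  have hb : ∀ (n : ℕ) v, ‖2 * (min |(a v : ℝ)| n / √n) * ‖F v‖‖ ≤
      2 * (|(a v : ℝ)| ^ (1 / 2 : ℝ) * ‖F v‖) := by
    intro n v
    have h0 : 0 ≤ min |(a v : ℝ)| (n : ℝ) / √n := by positivity
    rw [Real.norm_of_nonneg (by positivity), mul_assoc]
    gcongr
    exact hmin n (a v)
  have hlim : Tendsto (fun n : ℕ => ∑' v, 2 * (min |(a v : ℝ)| n / √n) * ‖F v‖) atTop
      (𝓝 (∑' _ : ι, (0 : ℝ))) := by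
    refine tendsto_tsum_of_dominated_convergence (hs.mul_left 2) (fun v => ?_)
      (Eventually.of_forall hb)
    have h1 : Tendsto (fun n : ℕ => |(a v : ℝ)| / √n) atTop (𝓝 0) :=
      tendsto_const_nhds.div_atTop
        (Real.tendsto_sqrt_atTop.comp tendsto_natCast_atTop_atTop)
    have h2 : Tendsto (fun n : ℕ => min |(a v : ℝ)| n / √n) atTop (𝓝 0) :=
      squeeze_zero (fun n => by positivity)
        (fun n => div_le_div_of_nonneg_right (min_le_left _ _) (Real.sqrt_nonneg _)) h1
    simpa using (h2.const_mul 2).mul_const ‖F v‖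
  rw [tsum_zero] at hlim
  refine squeeze_zero (fun n => by positivity) (fun n => ?_) hlim
  have hsn : Summable fun v => 2 * (min |(a v : ℝ)| n / √n) * ‖F v‖ :=
    Summable.of_norm_bounded (hs.mul_left 2) (hb n)
  rw [← (hS n).tsum_eq]
  rcases Nat.eq_zero_or_pos n with rfl | hn
  · simp
  have hn' : (0 : ℝ) < √n := Real.sqrt_pos.2 (by exact_mod_cast hn)
  have hle : ∀ v, ‖∑ i ∈ Finset.range n, T (i • e) (F v - T (a v • e) (F v))‖ ≤
      √n * (2 * (min |(a v : ℝ)| n / √n) * ‖F v‖) := by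
    intro v
    refine (hT.norm_sum_sub_le e n (a v) (F v)).trans (le_of_eq ?_)
    field_simp
  rw [div_le_iff₀ hn']
  calc _ ≤ ∑' v, √n * (2 * (min |(a v : ℝ)| n / √n) * ‖F v‖) :=
        tsum_of_norm_bounded (hsn.mul_left _).hasSum hle
    _ = _ := by rw [tsum_mul_left, mul_comm]

/-- The averages of `x` along multiples of `e`. -/
def avg (T : G → X →ₗᵢ[ℝ] X) (e : G) (n : ℕ) (x : X) : X :=
  (n : ℝ)⁻¹ • ∑ k ∈ Finset.range n, T (k • e) x

lemma avg_sub (T : G → X →ₗᵢ[ℝ] X) (e : G) (n : ℕ) (x y : X) :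
    avg T e n (x - y) = avg T e n x - avg T e n y := by
  simp [avg, smul_sub]

lemma avg_add (T : G → X →ₗᵢ[ℝ] X) (e : G) (n : ℕ) (x y : X) :
    avg T e n (x + y) = avg T e n x + avg T e n y := by
  simp [avg, smul_add, Finset.sum_add_distrib]

lemma map_avg (hT : IsIsometricAction T) (w e : G) (n : ℕ) (x : X) :
    T w (avg T e n x) = avg T e n (T w x) := by
  simp only [avg, map_smul, map_sum]
  congr 1
  exact Finset.sum_congr rfl fun k _ => hT.comm _ _ _

lemma tendsto_avg_coboundary (hT : IsIsometricAction T) (e : G) (u : X) :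
    Tendsto (fun n => avg T e n (u - T e u)) atTop (𝓝 0) := by
  rw [tendsto_zero_iff_norm_tendsto_zero]
  have h : Tendsto (fun n : ℕ => (2 * ‖u‖) / (n : ℝ)) atTop (𝓝 0) :=
    tendsto_const_nhds.div_atTop tendsto_natCast_atTop_atTop
  refine squeeze_zero (fun n => norm_nonneg _) (fun n => ?_) h
  rw [avg, hT.sum_sub, norm_smul, norm_inv, Real.norm_natCast, div_eq_inv_mul]
  gcongr
  refine (norm_sub_le _ _).trans ?_
  rw [LinearIsometry.norm_map]
  linarith

lemma map_nsmul_of_fixed (hT : IsIsometricAction T) {e : G} {x : X} (h : T e x = x) (n : ℕ) :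
    T (n • e) x = x := by
  induction n with
  | zero => simp [hT.zero]
  | succ n ih => rw [succ_nsmul, hT.add, h, ih]

/-- The flux through opposite sides of a large square cancels to leading order. -/
lemma tendsto_flux (hT : IsIsometricAction T) (e f : G) (U L : X)
    (hL : Tendsto (fun n => avg T f n U) atTop (𝓝 L))
    (h0 : Tendsto (fun n => avg T f n (U - T e U)) atTop (𝓝 0)) :
    Tendsto (fun n : ℕ => (n : ℝ)⁻¹ • ∑ i ∈ Finset.range n, ∑ j ∈ Finset.range n,
      T (i • e) (T (j • f) (U - T e U))) atTop (𝓝 0) := by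
  -- `T e` commutes with averaging along `f`, so the averages of `U - T e U` converge both to `L - T
  -- e L` and to zero.
  have hfix : T e L = L := by
    have h1 : Tendsto (fun n => avg T f n U - T e (avg T f n U)) atTop (𝓝 (L - T e L)) :=
      hL.sub (((T e).continuous.tendsto L).comp hL)
    simp only [hT.map_avg, ← avg_sub] at h1
    exact (sub_eq_zero.1 (tendsto_nhds_unique h1 h0)).symm
  -- Telescoping in `i` leaves the two opposite sides. Since `T (n • e)` fixes `L`, it may be
  -- subtracted from both, and only the ergodic error remains on each.
  have heq : ∀ n : ℕ, (n : ℝ)⁻¹ • ∑ i ∈ Finset.range n, ∑ j ∈ Finset.range n,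
      T (i • e) (T (j • f) (U - T e U)) = (avg T f n U - L) - T (n • e) (avg T f n U - L) := by
    intro n
    rw [Finset.sum_comm, map_sub, hT.map_nsmul_of_fixed hfix, sub_sub_sub_cancel_right,
      hT.map_avg, ← avg_sub, avg]
    congr 1
    refine Finset.sum_congr rfl fun j _ => ?_
    rw [← hT.sum_sub, map_sum]
    exact Finset.sum_congr rfl fun i _ => hT.comm _ _ _
  simp only [heq]
  have h2 : Tendsto (fun n => 2 * ‖avg T f n U - L‖) atTop (𝓝 0) := by
    simpa using (tendsto_iff_norm_sub_tendsto_zero.1 hL).const_mul 2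
  rw [tendsto_zero_iff_norm_tendsto_zero]
  refine squeeze_zero (fun n => norm_nonneg _) (fun n => ?_) h2
  refine (norm_sub_le _ _).trans ?_
  rw [LinearIsometry.norm_map]
  linarith

/-- Two-dimensional flow bound: a superposition of displacements with summable first moment,
whose averages along both axes vanish, has sums over squares of side `n` of size `o(n)`. -/
theorem tendsto_inv_smul_sum [CompleteSpace X] (hT : IsIsometricAction T) {ι : Type*} (e f : G)
    (hme : ∀ x, ∃ L, Tendsto (fun n => avg T e n x) atTop (𝓝 L))
    (hmf : ∀ x, ∃ L, Tendsto (fun n => avg T f n x) atTop (𝓝 L))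
    (F : ι → X) (a b : ι → ℤ)
    (hsa : Summable fun v => |(a v : ℝ)| * ‖F v‖) (hsb : Summable fun v => |(b v : ℝ)| * ‖F v‖)
    (D : X) (hD : HasSum (fun v => F v - T (a v • e + b v • f) (F v)) D)
    (hDe : Tendsto (fun n => avg T e n D) atTop (𝓝 0))
    (hDf : Tendsto (fun n => avg T f n D) atTop (𝓝 0)) :
    Tendsto (fun n : ℕ => (n : ℝ)⁻¹ • ∑ i ∈ Finset.range n, ∑ j ∈ Finset.range n,
      T (i • e) (T (j • f) D)) atTop (𝓝 0) := by
  -- The L-shaped path: `u v` records the flow along `e`, and `w v` the flow along `f` starting from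
  -- the corner `T (a v • e) (F v)`.
  choose u hu hu' using fun v => hT.exists_coboundary e (a v) (F v)
  choose w hw hw' using fun v => hT.exists_coboundary f (b v) (T (a v • e) (F v))
  simp only [LinearIsometry.norm_map] at hw
  have hU := (Summable.of_norm_bounded hsa hu).hasSum
  have hW := (Summable.of_norm_bounded hsb hw).hasSum
  set U := ∑' v, u v
  set W := ∑' v, w v
  have hDUW : D = (U - T e U) + (W - T f W) := by
    refine hD.unique ?_
    have h1 := (hU.sub ((T e).toContinuousLinearMap.hasSum hU)).add
      (hW.sub ((T f).toContinuousLinearMap.hasSum hW))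
    simp only [LinearIsometry.coe_toContinuousLinearMap] at h1
    convert h1 using 1
    funext v
    rw [← hu', ← hw', ← hT.add, add_comm (b v • f)]
    abel
  obtain ⟨LU, hLU⟩ := hmf U
  obtain ⟨LW, hLW⟩ := hme W
  -- Averaging along `f` kills both `D` and the coboundary `W - T f W`, hence also the remaining
  -- part of `D`.
  have hUf : Tendsto (fun n => avg T f n (U - T e U)) atTop (𝓝 0) := by
    have := hDf.sub (hT.tendsto_avg_coboundary f W)
    simp only [hDUW, avg_add, add_sub_cancel_right, sub_zero] at this
    exact this
  have hWe : Tendsto (fun n => avg T e n (W - T f W)) atTop (𝓝 0) := by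
    have := hDe.sub (hT.tendsto_avg_coboundary e U)
    simp only [hDUW, avg_add, add_sub_cancel_left, sub_zero] at this
    exact this
  have h1 := hT.tendsto_flux e f U LU hLU hUf
  have h2 := hT.tendsto_flux f e W LW hLW hWe
  rw [← add_zero (0 : X)]
  refine (h1.add h2).congr fun n => ?_
  rw [← smul_add, Finset.sum_comm (f := fun i j => T (i • f) (T (j • e) (W - T f W))),
    ← Finset.sum_add_distrib]
  congr 1
  refine Finset.sum_congr rfl fun i _ => ?_
  rw [← Finset.sum_add_distrib]
  refine Finset.sum_congr rfl fun j _ => ?_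
  rw [hT.comm (j • f) (i • e), ← map_add, ← map_add, ← hDUW]

end IsIsometricAction

end Isometric

/-! ### The mean ergodic theorem in `L¹`. -/

section MeanErgodic

variable {α : Type*} [MeasurableSpace α] {μ : Measure α}

/-- If a linear isometry has convergent averages on a dense set then it has convergent averages
everywhere. -/
lemma exists_tendsto_birkhoffAverage_of_dense {X : Type*} [NormedAddCommGroup X] [NormedSpace ℝ X]
    [CompleteSpace X] (T : X →ₗᵢ[ℝ] X) (S : Set X) (hS : Dense S)
    (h : ∀ x ∈ S, CauchySeq (fun n => birkhoffAverage ℝ T id n x)) (x : X) :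
    ∃ L, Tendsto (fun n => birkhoffAverage ℝ T id n x) atTop (𝓝 L) := by
  refine cauchySeq_tendsto_of_complete ?_
  have hl : LipschitzWith 1 T := T.isometry.lipschitz
  -- Averages are contractions uniformly in `n`, which allows an `ε/3` argument from the dense set.
  have hc : ∀ (n : ℕ) (x y : X),
      dist (birkhoffAverage ℝ T id n x) (birkhoffAverage ℝ T id n y) ≤ dist x y := by
    intro n x y
    refine (dist_birkhoffAverage_birkhoffAverage_le ℝ T id n x y).trans ?_
    have : ∀ k, dist (id (T^[k] x)) (id (T^[k] y)) ≤ dist x y := fun k => by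
      simpa using (hl.iterate k).dist_le_mul x y
    rcases Nat.eq_zero_or_pos n with rfl | hn
    · simp
    · have hn' : (0 : ℝ) < n := by exact_mod_cast hn
      rw [div_le_iff₀ hn']
      refine (Finset.sum_le_sum fun k _ => this k).trans ?_
      simp [mul_comm]
  rw [Metric.cauchySeq_iff]
  intro ε hε
  obtain ⟨y, hyS, hy⟩ := Metric.dense_iff.1 hS x (ε / 3) (by positivity) |>.imp fun y hy => hy.symm
  rw [Metric.mem_ball, dist_comm] at hy
  obtain ⟨N, hN⟩ := Metric.cauchySeq_iff.1 (h y hyS) (ε / 3) (by positivity)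
  refine ⟨N, fun m hm n hn => ?_⟩
  have h1 := hc m x y
  have h2 := hc n x y
  have h3 := hN m hm n hn
  have h4 := dist_triangle4 (birkhoffAverage ℝ T id m x) (birkhoffAverage ℝ T id m y)
    (birkhoffAverage ℝ T id n y) (birkhoffAverage ℝ T id n x)
  rw [dist_comm (birkhoffAverage ℝ T id n y)] at h4
  linarith

/-- The Koopman operator on `L¹`. -/
abbrev koopman (τ : α → α) (hτ : MeasurePreserving τ μ μ) : Lp ℝ 1 μ →ₗᵢ[ℝ] Lp ℝ 1 μ :=
  Lp.compMeasurePreservingₗᵢ ℝ τ hτ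

/-- The **mean ergodic theorem** in `L¹` of a probability space. -/
theorem exists_tendsto_birkhoffAverage_koopman [IsProbabilityMeasure μ] (τ : α → α)
    (hτ : MeasurePreserving τ μ μ) (x : Lp ℝ 1 μ) :
    ∃ L, Tendsto (fun n => birkhoffAverage ℝ (koopman τ hτ) id n x) atTop (𝓝 L) := by
  let T2 : Lp ℝ 2 μ →ₗᵢ[ℝ] Lp ℝ 2 μ := Lp.compMeasurePreservingₗᵢ ℝ τ hτ
  -- On a probability space the inclusion of `L²` in `L¹` is a contraction commuting with the
  -- Koopman operators. It carries von Neumann's theorem to a subset of `L¹` that is dense because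
  -- it contains the simple functions.
  let J : Lp ℝ 2 μ → Lp ℝ 1 μ := fun f => ((Lp.memLp f).mono_exponent one_le_two).toLp f
  have hJ_sub : ∀ f g, J f - J g = J (f - g) := by
    intro f g
    rw [← MemLp.toLp_sub]
    exact (MemLp.toLp_eq_toLp_iff _ _).2 (Lp.coeFn_sub f g).symm
  have hJ_norm : ∀ f, ‖J f‖ ≤ ‖f‖ := by
    intro f
    rw [Lp.norm_toLp, Lp.norm_def]
    exact ENNReal.toReal_mono (Lp.memLp f).eLpNorm_ne_top
      (eLpNorm_le_eLpNorm_of_exponent_le one_le_two (Lp.aestronglyMeasurable f))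
  have hJ_smul : ∀ (c : ℝ) f, J (c • f) = c • J f := by
    intro c f
    rw [← MemLp.toLp_const_smul]
    exact (MemLp.toLp_eq_toLp_iff _ _).2 (Lp.coeFn_smul c f)
  have hJ_add : ∀ f g, J (f + g) = J f + J g := by
    intro f g
    rw [← MemLp.toLp_add]
    exact (MemLp.toLp_eq_toLp_iff _ _).2 (Lp.coeFn_add f g)
  have hJ_zero : J 0 = 0 := by simpa using hJ_smul 0 0
  have hJ_T : ∀ f, koopman τ hτ (J f) = J (T2 f) := by
    intro f
    change Lp.compMeasurePreserving τ hτ (MemLp.toLp _ _) = _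
    rw [Lp.toLp_compMeasurePreserving]
    exact (MemLp.toLp_eq_toLp_iff _ _).2 (Lp.coeFn_compMeasurePreserving f hτ).symm
  have hJ_it : ∀ k f, (koopman τ hτ)^[k] (J f) = J (T2^[k] f) := by
    intro k f
    induction k with
    | zero => rfl
    | succ k ih => rw [Function.iterate_succ_apply', Function.iterate_succ_apply', ih, hJ_T]
  have hJ_avg : ∀ n f, birkhoffAverage ℝ (koopman τ hτ) id n (J f) =
      J (birkhoffAverage ℝ T2 id n f) := by
    intro n f
    have : ∀ s : Finset ℕ, ∑ k ∈ s, (koopman τ hτ)^[k] (J f) = J (∑ k ∈ s, T2^[k] f) := by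
      intro s
      induction s using Finset.induction_on with
      | empty => simp [hJ_zero]
      | insert a s ha ih => rw [Finset.sum_insert ha, Finset.sum_insert ha, ih, hJ_add, hJ_it]
    simp only [birkhoffAverage, birkhoffSum, id, hJ_smul, this]
  refine exists_tendsto_birkhoffAverage_of_dense (koopman τ hτ) (Set.range J) ?_ ?_ x
  · refine (Lp.simpleFunc.dense ENNReal.one_ne_top).mono ?_
    intro g hg
    obtain ⟨s, hs⟩ := (hg : ∃ s : SimpleFunc α ℝ, (AEEqFun.mk s s.aestronglyMeasurable : α →ₘ[μ] ℝ) = g)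
    have hs2 : MemLp s 2 μ := SimpleFunc.memLp_of_isFiniteMeasure s 2 μ
    refine ⟨hs2.toLp s, ?_⟩
    apply Lp.ext
    refine (MemLp.coeFn_toLp _).trans ((MemLp.coeFn_toLp _).trans ?_)
    rw [← hs]
    exact (AEEqFun.coeFn_mk _ _).symm
  · rintro _ ⟨f, rfl⟩
    have h := (ContinuousLinearMap.tendsto_birkhoffAverage_orthogonalProjection
      T2.toContinuousLinearMap T2.norm_toContinuousLinearMap_le f).cauchySeq
    rw [Metric.cauchySeq_iff] at h ⊢
    intro ε hε
    obtain ⟨N, hN⟩ := h ε hε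
    refine ⟨N, fun m hm n hn => lt_of_le_of_lt ?_ (hN m hm n hn)⟩
    rw [hJ_avg, hJ_avg, dist_eq_norm, dist_eq_norm, hJ_sub]
    exact hJ_norm _

end MeanErgodic

/-! ### Fluctuations of Poisson variables. -/

section Poisson

open scoped Nat

/-- The identity `E[N g(N - 1)] = r E[g(N)]`, from `n / n! = 1 / (n - 1)!`; it yields the first two
moments. The truncated `0 - 1` is harmless because of the factor `n`. -/
lemma hasSum_poisson_mul_succ (r : ℝ≥0) (g : ℕ → ℝ) (s : ℝ)
    (h : HasSum (fun n : ℕ => Real.exp (-r) * r ^ n / n ! * g n) s) :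
    HasSum (fun n : ℕ => Real.exp (-r) * r ^ n / n ! * (n * g (n - 1))) (r * s) := by
  rw [← hasSum_nat_add_iff' 1]
  have h0 : ∑ i ∈ Finset.range 1, Real.exp (-r) * (r : ℝ) ^ i / i ! * (i * g (i - 1)) = 0 := by simp
  rw [h0, sub_zero]
  have h1 : (fun n : ℕ => Real.exp (-r) * (r : ℝ) ^ (n + 1) / (n + 1)! *
      (((n + 1 : ℕ) : ℝ) * g (n + 1 - 1))) =
      fun n => (r : ℝ) * (Real.exp (-r) * r ^ n / n ! * g n) := by
    funext n
    have : (n ! : ℝ) ≠ 0 := by positivity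
    simp only [Nat.factorial_succ, Nat.add_sub_cancel]
    push_cast
    field_simp
    ring
  rw [h1]
  exact h.mul_left (r : ℝ)

lemma hasSum_poisson_mean (r : ℝ≥0) :
    HasSum (fun n : ℕ => Real.exp (-r) * r ^ n / n ! * n) r := by
  simpa using hasSum_poisson_mul_succ r (fun _ => 1) 1 (by simpa using hasSum_one_poissonMeasure r)

lemma hasSum_poisson_sq (r : ℝ≥0) :
    HasSum (fun n : ℕ => Real.exp (-r) * r ^ n / n ! * (n : ℝ) ^ 2) (r * r + r) := by
  have h := hasSum_poisson_mul_succ r (fun n => (n : ℝ)) r (hasSum_poisson_mean r)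
  convert h.add (hasSum_poisson_mean r) using 1
  funext n
  cases n with
  | zero => simp
  | succ n => push_cast [Nat.add_sub_cancel]; ring

lemma integrable_poisson_id (r : ℝ≥0) : Integrable (fun n : ℕ => (n : ℝ)) (poissonMeasure r) := by
  rw [integrable_poissonMeasure_iff]
  simpa using (hasSum_poisson_mean r).summable

lemma integrable_poisson_sq (r : ℝ≥0) :
    Integrable (fun n : ℕ => (n : ℝ) ^ 2) (poissonMeasure r) := by
  rw [integrable_poissonMeasure_iff]
  simpa using (hasSum_poisson_sq r).summable

lemma integral_poisson_id (r : ℝ≥0) : ∫ n, (n : ℝ) ∂poissonMeasure r = r := by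
  rw [integral_poissonMeasure]
  exact (hasSum_poisson_mean r).tsum_eq

lemma integral_poisson_sq (r : ℝ≥0) : ∫ n, (n : ℝ) ^ 2 ∂poissonMeasure r = r * r + r := by
  rw [integral_poissonMeasure]
  exact (hasSum_poisson_sq r).tsum_eq

lemma integral_poisson_sub_sq (r : ℝ≥0) :
    Integrable (fun n : ℕ => ((n : ℝ) - r) ^ 2) (poissonMeasure r) ∧
      ∫ n, ((n : ℝ) - r) ^ 2 ∂poissonMeasure r = r := by
  have heq : (fun n : ℕ => ((n : ℝ) - r) ^ 2) =
      fun n : ℕ => (n : ℝ) ^ 2 - 2 * r * n + (r : ℝ) ^ 2 := by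
    funext n
    ring
  have h1 := (integrable_poisson_id r).const_mul (2 * (r : ℝ))
  have h2 : Integrable (fun n : ℕ => (n : ℝ) ^ 2 - 2 * r * n) (poissonMeasure r) :=
    (integrable_poisson_sq r).sub h1
  rw [heq]
  refine ⟨h2.add (integrable_const _), ?_⟩
  rw [integral_add h2 (integrable_const _), integral_sub (integrable_poisson_sq r) h1,
    integral_const_mul, integral_poisson_sq, integral_poisson_id, integral_const]
  simp only [probReal_univ, one_smul]
  ring

/-- This is `(|a| - s)² ≥ 0`. Integrated with `s` the root mean square, it bounds the first absolute
moment as Cauchy–Schwarz would. -/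
lemma abs_le_inv_mul_sq_add {s : ℝ} (hs : 0 < s) (a : ℝ) : |a| ≤ (2 * s)⁻¹ * a ^ 2 + s / 2 := by
  have h : (2 * s)⁻¹ * a ^ 2 + s / 2 = (a ^ 2 + s * s) / (2 * s) := by
    field_simp
  rw [h, le_div_iff₀ (by positivity), ← sq_abs]
  nlinarith [sq_nonneg (|a| - s)]

lemma integral_abs_le_sqrt {α : Type*} [MeasurableSpace α] {μ : Measure α} [IsProbabilityMeasure μ]
    {f : α → ℝ} (hf : Integrable f μ) (hf2 : Integrable (fun a => f a ^ 2) μ)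
    (hpos : 0 < ∫ a, f a ^ 2 ∂μ) : ∫ a, |f a| ∂μ ≤ √(∫ a, f a ^ 2 ∂μ) := by
  set v := ∫ a, f a ^ 2 ∂μ with hv
  have hs : 0 < √v := Real.sqrt_pos.2 hpos
  have hi' := hf2.const_mul (2 * √v)⁻¹
  calc ∫ a, |f a| ∂μ ≤ ∫ a, ((2 * √v)⁻¹ * f a ^ 2 + √v / 2) ∂μ :=
        integral_mono hf.abs (hi'.add (integrable_const _)) fun a => abs_le_inv_mul_sq_add hs _
    _ = (2 * √v)⁻¹ * v + √v / 2 := by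
        rw [integral_add hi' (integrable_const _), integral_const_mul, ← hv]
        simp
    _ = (2 * √v)⁻¹ * (√v * √v) + √v / 2 := by rw [Real.mul_self_sqrt hpos.le]
    _ = √v := by
        field_simp
        norm_num

lemma integral_abs_sub_poisson_le (r : ℝ≥0) (hr : 0 < r) :
    ∫ n, |(n : ℝ) - r| ∂poissonMeasure r ≤ √r := by
  obtain ⟨hi, hint⟩ := integral_poisson_sub_sq r
  have h := integral_abs_le_sqrt ((integrable_poisson_id r).sub (integrable_const (r : ℝ))) hi
    (hint.symm ▸ (NNReal.coe_pos.2 hr))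
  exact h.trans_eq (congrArg Real.sqrt hint)

variable {Ω : Type*} [MeasurableSpace Ω] {P : Measure Ω}

/-- A random variable with a Poisson distribution. -/
def IsPoissonVar (r : ℝ≥0) (X : Ω → ℝ) (P : Measure Ω) : Prop :=
  P.map X = (poissonMeasure r).map (fun n : ℕ => (n : ℝ))

namespace IsPoissonVar

variable {r : ℝ≥0} {X Y : Ω → ℝ}

lemma integrable (hX : Measurable X) (h : IsPoissonVar r X P) : Integrable X P := by
  have h1 : Integrable id (P.map X) := by
    rw [h, integrable_map_measure (by fun_prop) .of_discrete]
    exact integrable_poisson_id r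
  exact (integrable_map_measure (by fun_prop) hX.aemeasurable).1 h1

lemma integral_abs_sub_le (hX : Measurable X) (h : IsPoissonVar r X P) (hr : 0 < r) :
    ∫ ω, |X ω - r| ∂P ≤ √r := by
  have h1 : ∫ ω, |X ω - r| ∂P = ∫ x, |x - r| ∂(P.map X) := by
    rw [integral_map hX.aemeasurable]
    exact (by fun_prop : Continuous fun x : ℝ => |x - r|).aestronglyMeasurable
  rw [h1, h, integral_map .of_discrete]
  · exact integral_abs_sub_poisson_le r hr
  · exact (by fun_prop : Continuous fun x : ℝ => |x - r|).aestronglyMeasurable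

lemma integral_abs_diff_le [IsProbabilityMeasure P] (hX : Measurable X) (hY : Measurable Y) (h : IsPoissonVar r X P)
    (h' : IsPoissonVar r Y P) (hr : 0 < r) : ∫ ω, |X ω - Y ω| ∂P ≤ 2 * √r := by
  have hiX := ((h.integrable hX).sub (integrable_const (r : ℝ))).abs
  have hiY := ((h'.integrable hY).sub (integrable_const (r : ℝ))).abs
  calc ∫ ω, |X ω - Y ω| ∂P ≤ ∫ ω, (|X ω - r| + |Y ω - r|) ∂P := by
        refine integral_mono ((h.integrable hX).sub (h'.integrable hY)).abs (hiX.add hiY) ?_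
        intro ω
        have := abs_sub_le (X ω) r (Y ω)
        rwa [abs_sub_comm (r : ℝ)] at this
    _ = ∫ ω, |X ω - r| ∂P + ∫ ω, |Y ω - r| ∂P := integral_add hiX hiY
    _ ≤ 2 * √r := by
        linarith [h.integral_abs_sub_le hX hr, h'.integral_abs_sub_le hY hr]

-- By independence the exponents `r (e^{it} - 1)` and `r (e^{-it} - 1)` add up, and `e^{it} +
-- e^{-it} = 2 cos t`.
open Complex in
lemma charFun_diff [IsProbabilityMeasure P] (hX : Measurable X) (hY : Measurable Y) (h : IsPoissonVar r X P)
    (h' : IsPoissonVar r Y P) (hXY : IndepFun X Y P) (t : ℝ) :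
    charFun (P.map (fun ω => X ω - Y ω)) t = ((Real.exp (2 * r * (Real.cos t - 1)) : ℝ) : ℂ) := by
  have hneg : P.map (-Y) = (P.map Y).map (fun x => -1 * x) := by
    rw [Measure.map_map (by fun_prop) hY]
    congr 1
    funext ω
    simp
  have hind : IndepFun X (fun ω => -Y ω) P := hXY.comp measurable_id measurable_neg
  have h1 := congrFun (hind.charFun_map_add_eq_mul hX.aemeasurable hY.neg.aemeasurable) t
  have h2 : X + -Y = fun ω => X ω - Y ω := by
    funext ω
    simp [sub_eq_add_neg]
  rw [h2, Pi.mul_apply, hneg, charFun_map_mul, h, h', charFun_map_cast_poissonMeasure,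
    charFun_map_cast_poissonMeasure, ← Complex.exp_add] at h1
  rw [h1]
  push_cast
  congr 1
  rw [Complex.cos]
  have : ((-1 : ℂ) * t * I) = -(t : ℂ) * I := by ring
  rw [this]
  ring

/-- From `|e^{ix} - 1| ≤ |x|`: a characteristic function away from `1` forces a large first absolute
moment. -/
lemma one_sub_exp_le [IsProbabilityMeasure P] (hX : Measurable X) (hY : Measurable Y) (h : IsPoissonVar r X P)
    (h' : IsPoissonVar r Y P) (hXY : IndepFun X Y P) (t : ℝ) :
    1 - Real.exp (2 * r * (Real.cos t - 1)) ≤ |t| * ∫ ω, |X ω - Y ω| ∂P := by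
  have hm : Measurable fun ω => X ω - Y ω := hX.sub hY
  have hi : Integrable (fun ω => |X ω - Y ω|) P := ((h.integrable hX).sub (h'.integrable hY)).abs
  have hc := charFun_diff hX hY h h' hXY t
  rw [charFun_apply, integral_map hm.aemeasurable (by fun_prop)] at hc
  simp only [Real.inner_apply] at hc
  have hie : Integrable (fun ω => Complex.exp (((X ω - Y ω) * t : ℝ) * Complex.I)) P := by
    refine (integrable_const (1 : ℝ)).mono' ?_ (Eventually.of_forall fun ω => ?_)
    · exact (by fun_prop : Measurable fun ω =>
        Complex.exp (((X ω - Y ω) * t : ℝ) * Complex.I)).aestronglyMeasurable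
    · rw [Complex.norm_exp_ofReal_mul_I]
  have h1 : ((Real.exp (2 * r * (Real.cos t - 1)) : ℝ) : ℂ) - 1 =
      ∫ ω, (Complex.exp (((X ω - Y ω) * t : ℝ) * Complex.I) - 1) ∂P := by
    rw [integral_sub hie (integrable_const _), ← hc]
    simp
  have h2 : ‖((Real.exp (2 * r * (Real.cos t - 1)) : ℝ) : ℂ) - 1‖ ≤
      ∫ ω, |t| * |X ω - Y ω| ∂P := by
    rw [h1]
    refine norm_integral_le_of_norm_le (hi.const_mul _) (Eventually.of_forall fun ω => ?_)
    have := Real.norm_exp_I_mul_ofReal_sub_one_le (x := (X ω - Y ω) * t)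
    rw [mul_comm Complex.I] at this
    refine this.trans (le_of_eq ?_)
    rw [Real.norm_eq_abs, abs_mul, mul_comm]
  rw [integral_const_mul] at h2
  refine le_trans ?_ h2
  rw [← Complex.ofReal_one, ← Complex.ofReal_sub, Complex.norm_real, Real.norm_eq_abs, abs_sub_comm]
  exact le_abs_self _

/-- Independent Poisson variables with the same mean `r` differ by order `√r`. -/
lemma sqrt_mul_le_integral_abs_diff [IsProbabilityMeasure P] (hX : Measurable X) (hY : Measurable Y) (h : IsPoissonVar r X P)
    (h' : IsPoissonVar r Y P) (hXY : IndepFun X Y P) (hr : 1 ≤ r) :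
    √r * (1 - Real.exp (-(4 / Real.pi ^ 2))) ≤ ∫ ω, |X ω - Y ω| ∂P := by
  have hr' : (1 : ℝ) ≤ r := by exact_mod_cast hr
  have hs1 : 1 ≤ √(r : ℝ) := Real.one_le_sqrt.2 hr'
  have hs : 0 < √(r : ℝ) := by linarith
  -- The frequency `1/√r` matches the scale of the fluctuations. As `r ≥ 1` it lies in `[0, π]`,
  -- where `cos x ≤ 1 - (2/π²) x²`, so the exponent is at most `-4/π²` whatever `r` is.
  have hle := one_sub_exp_le hX hY h h' hXY (√r)⁻¹
  have habs : |(√(r : ℝ))⁻¹| = (√r)⁻¹ := abs_of_pos (by positivity)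
  have hcos := Real.cos_le_one_sub_mul_cos_sq (x := (√(r : ℝ))⁻¹) (by
    rw [habs]
    exact (inv_le_one_of_one_le₀ hs1).trans (by linarith [Real.pi_gt_three]))
  have hexp : Real.exp (2 * r * (Real.cos (√r)⁻¹ - 1)) ≤ Real.exp (-(4 / Real.pi ^ 2)) := by
    refine Real.exp_le_exp.2 ?_
    have h1 : ((√(r : ℝ))⁻¹) ^ 2 = (r : ℝ)⁻¹ := by rw [inv_pow, Real.sq_sqrt r.coe_nonneg]
    rw [h1] at hcos
    have h2 : 2 * (r : ℝ) * (Real.cos (√r)⁻¹ - 1) ≤ 2 * r * (-(2 / Real.pi ^ 2 * (r : ℝ)⁻¹)) := by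
      gcongr
      linarith
    refine h2.trans (le_of_eq ?_)
    field_simp
    norm_num
  rw [habs, inv_mul_eq_div, le_div_iff₀ hs] at hle
  nlinarith

end IsPoissonVar

lemma one_sub_exp_neg_pos : 0 < 1 - Real.exp (-(4 / Real.pi ^ 2)) := by
  have : Real.exp (-(4 / Real.pi ^ 2)) < 1 := Real.exp_lt_one_iff.2 (by
    have := Real.pi_pos
    rw [neg_lt_zero]
    positivity)
  linarith

variable {d : ℕ}

lemma isPoissonVar_count {N : Ω → Measure (Space d)} (hN : IsPoissonProcess 1 N P)
    {A : Set (Space d)} (hA : MeasurableSet A) (hb : Bornology.IsBounded A) :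
    IsPoissonVar (volume A).toNNReal (fun ω => (N ω A).toReal) P := by
  have h := hN.count_law A hA hb
  have hm : Measurable fun ω => N ω A :=
    (Measure.measurable_coe hA).comp hN.isSimplePointProcess.measurable
  have h2 := congrArg (fun μ => Measure.map ENNReal.toReal μ) h
  rw [Measure.map_map ENNReal.measurable_toReal hm,
    Measure.map_map ENNReal.measurable_toReal .of_discrete, one_mul] at h2
  exact h2

lemma lintegral_count {N : Ω → Measure (Space d)} (hN : IsPoissonProcess 1 N P)
    {A : Set (Space d)} (hA : MeasurableSet A) (hb : Bornology.IsBounded A) :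
    ∫⁻ ω, N ω A ∂P = volume A := by
  have h := hN.count_law A hA hb
  have hm : Measurable fun ω => N ω A :=
    (Measure.measurable_coe hA).comp hN.isSimplePointProcess.measurable
  have h1 : ∫⁻ ω, N ω A ∂P = ∫⁻ x, x ∂(P.map fun ω => N ω A) := by
    rw [lintegral_map measurable_id' hm]
  rw [h1, h, lintegral_map measurable_id' .of_discrete, one_mul]
  have h2 : ∀ n : ℕ, (n : ℝ≥0∞) = ENNReal.ofReal (n : ℝ) := fun n => by simp
  simp only [h2]
  rw [← ofReal_integral_eq_lintegral_ofReal (integrable_poisson_id _)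
    (Eventually.of_forall fun n => by positivity), integral_poisson_id]
  simp [ENNReal.ofReal_coe_nnreal, hb.measure_lt_top.ne]

end Poisson

/-! ### Lattice cubes and integer shifts. -/

section Cells

variable {d : ℕ}

/-- The index of the half-open unit lattice cube containing `x`. -/
def cellIndex (x : Space d) : Fin d → ℤ := fun i => ⌊x i⌋

lemma measurable_cellIndex : Measurable (cellIndex (d := d)) := by
  refine measurable_pi_lambda _ fun i => Int.measurable_floor.comp ?_
  fun_prop

/-- The half-open unit lattice cube with index `p`. -/
def cell (p : Fin d → ℤ) : Set (Space d) := cellIndex ⁻¹' {p}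

lemma measurableSet_cell (p : Fin d → ℤ) : MeasurableSet (cell p) :=
  measurable_cellIndex (measurableSet_singleton p)

lemma mem_cell {p : Fin d → ℤ} {x : Space d} :
    x ∈ cell p ↔ ∀ i, (p i : ℝ) ≤ x i ∧ x i < p i + 1 := by
  simp [cell, cellIndex, funext_iff, Int.floor_eq_iff]

lemma unitCube_eq_cell : unitCube d = cell 0 := by
  ext x
  simp [mem_cell, unitCube]

lemma cell_eq_preimage (p : Fin d → ℤ) : cell p = (MeasurableEquiv.toLp 2 (Fin d → ℝ)).symm ⁻¹'
    (Set.univ.pi fun i => Set.Ico (p i : ℝ) (p i + 1)) := by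
  ext x
  simp [mem_cell, Set.mem_pi]

lemma volume_cell (p : Fin d → ℤ) : volume (cell p) = 1 := by
  rw [cell_eq_preimage, (EuclideanSpace.volume_preserving_symm_measurableEquiv_toLp
    (Fin d)).measure_preimage_equiv, Real.volume_pi_Ico]
  simp

lemma isBounded_cell (p : Fin d → ℤ) : Bornology.IsBounded (cell p) := by
  have h : Bornology.IsBounded (Set.univ.pi fun i => Set.Icc (p i : ℝ) (p i + 1)) :=
    (isCompact_univ_pi fun i => isCompact_Icc).isBounded
  refine ((PiLp.antilipschitzWith_ofLp 2 (fun _ : Fin d => ℝ)).isBounded_preimage h).subset ?_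
  intro x hx i _
  exact ⟨((mem_cell.1 hx) i).1, ((mem_cell.1 hx) i).2.le⟩

/-- The union of the lattice cubes with indices in a finite set. -/
def cells (S : Finset (Fin d → ℤ)) : Set (Space d) := cellIndex ⁻¹' S

lemma cells_eq_biUnion (S : Finset (Fin d → ℤ)) : cells S = ⋃ p ∈ S, cell p := by
  ext x
  simp [cells, cell]

lemma measurableSet_cells (S : Finset (Fin d → ℤ)) : MeasurableSet (cells S) :=
  measurable_cellIndex S.measurableSet

lemma measure_cells (μ : Measure (Space d)) (S : Finset (Fin d → ℤ)) :
    μ (cells S) = ∑ p ∈ S, μ (cell p) := by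
  rw [cells_eq_biUnion, measure_biUnion_finset]
  · intro p _ q _ hpq
    exact Disjoint.preimage _ (by simpa using hpq)
  · exact fun p _ => measurableSet_cell p

lemma volume_cells (S : Finset (Fin d → ℤ)) : volume (cells S) = S.card := by
  simp [measure_cells, volume_cell]

lemma isBounded_cells (S : Finset (Fin d → ℤ)) : Bornology.IsBounded (cells S) := by
  rw [cells_eq_biUnion]
  exact (Bornology.isBounded_biUnion_finset S).2 fun p _ => isBounded_cell p

/-- An integer vector as a point of Euclidean space. -/
def intVec (v : Fin d → ℤ) : Space d := WithLp.toLp 2 fun i => (v i : ℝ)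

/-- Translation by an integer vector. -/
def shift (v : Fin d → ℤ) (x : Space d) : Space d := x + intVec v

lemma measurable_shift (v : Fin d → ℤ) : Measurable (shift v) := measurable_id.add_const _

lemma shift_injective (v : Fin d → ℤ) : Function.Injective (shift v) := add_left_injective _

lemma shift_shift (v w : Fin d → ℤ) (x : Space d) : shift v (shift w x) = shift (w + v) x := by
  ext i
  simp [shift, intVec, add_assoc]

lemma shift_zero : shift (0 : Fin d → ℤ) = id := by
  funext x
  ext i
  simp [shift, intVec]

lemma shift_preimage_cell (v p : Fin d → ℤ) : shift v ⁻¹' cell p = cell (p - v) := by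
  ext x
  simp only [Set.mem_preimage, cell, cellIndex, shift, intVec, Set.mem_singleton_iff, funext_iff,
    PiLp.add_apply, Int.floor_add_intCast, Pi.sub_apply]
  exact forall_congr' fun i => eq_sub_iff_add_eq.symm

lemma abs_le_norm_sub_add_one {v : Fin d → ℤ} {x y : Space d} (hx : x ∈ cell 0) (hy : y ∈ cell v)
    (i : Fin d) : |(v i : ℝ)| ≤ ‖x - y‖ + 1 := by
  have h1 := (mem_cell.1 hx) i
  have h2 := (mem_cell.1 hy) i
  have h3 := PiLp.norm_apply_le (x - y) i
  rw [PiLp.sub_apply, Real.norm_eq_abs, abs_le] at h3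
  simp only [Pi.zero_apply, Int.cast_zero, zero_add] at h1
  rw [abs_le]
  constructor <;> linarith

end Cells

/-! ### Point measures, measurability of atoms, and oriented edges. -/

section PointMeasures

variable {α : Type*} [MeasurableSpace α]

lemma encard_eq_tsum_indicator {β : Type*} (s : Set β) :
    ((s.encard : ℕ∞) : ℝ≥0∞) = ∑' z, s.indicator (fun _ => (1 : ℝ≥0∞)) z := by
  rw [← tsum_subtype s, ENNReal.tsum_set_one]

lemma tsum_encard_fiber {β γ : Type*} (s : Set β) (f : β → γ) :
    ∑' p, (((s ∩ f ⁻¹' {p}).encard : ℕ∞) : ℝ≥0∞) = ((s.encard : ℕ∞) : ℝ≥0∞) := by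
  classical
  simp only [encard_eq_tsum_indicator]
  rw [ENNReal.tsum_comm]
  refine tsum_congr fun z => ?_
  rw [tsum_eq_single (f z)]
  · simp [Set.indicator_apply]
  · intro p hp
    simp [hp.symm]

lemma IsSimplePointMeasure.apply {m : Measure α} (hm : IsSimplePointMeasure m) {S : Set α}
    (hS : MeasurableSet S) : m S = (((pointSet m ∩ S).encard : ℕ∞) : ℝ≥0∞) := by
  conv_lhs => rw [hm.2]
  rw [Measure.sum_apply _ hS, encard_eq_tsum_indicator]
  have h : ∀ x : α, (pointSet m ∩ S).indicator (fun _ => (1 : ℝ≥0∞)) x =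
      (pointSet m).indicator (fun x => Measure.dirac x S) x := by
    intro x
    by_cases hx : x ∈ pointSet m <;> by_cases hxS : x ∈ S <;>
      simp [hx, hxS, Measure.dirac_apply' _ hS]
  simp only [h]
  rw [← tsum_subtype (pointSet m) (fun x => Measure.dirac x S)]

/-- The part of a measure in a window, provided that it is finite. -/
def finPart (W : Set α) (m : Measure α) : Measure α :=
  open Classical in if m W < ∞ then m.restrict W else 0

instance (W : Set α) (m : Measure α) : IsFiniteMeasure (finPart W m) := by
  unfold finPart
  split_ifs with h
  · exact ⟨by simpa using h⟩
  · infer_instance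

lemma measurable_finPart {W : Set α} (hW : MeasurableSet W) : Measurable (finPart W) := by
  classical
  refine Measure.measurable_of_measurable_coe _ fun S hS => ?_
  have h : (fun m : Measure α => finPart W m S) = fun m => if m W < ∞ then m (S ∩ W) else 0 := by
    funext m
    unfold finPart
    split_ifs <;> simp [Measure.restrict_apply hS]
  rw [h]
  exact Measurable.ite (measurableSet_lt (Measure.measurable_coe hW) measurable_const)
    (Measure.measurable_coe (hS.inter hW)) measurable_const

lemma finPart_map {W : Set α} (hW : MeasurableSet W) (m : Measure α) {τ : α → α}
    (hτ : Measurable τ) : finPart W (m.map τ) = (finPart (τ ⁻¹' W) m).map τ := by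
  unfold finPart
  rw [Measure.map_apply hτ hW]
  split_ifs
  · rw [Measure.restrict_map hτ hW]
  · simp

/-- The mass at a moving point is the mass of a section of the diagonal, so it is jointly measurable
for a finite kernel. This is the reason for truncating with `finPart`. -/
lemma measurable_atom [MeasurableEq α] {Y : Type*} [MeasurableSpace Y] {N : Y → Measure α}
    (hN : Measurable N) (hfin : ∀ y, IsFiniteMeasure (N y)) :
    Measurable fun z : Y × α => N z.1 {z.2} := by
  let κ : Kernel (Y × α) α := ⟨fun z => N z.1, hN.comp measurable_fst⟩
  have ht : MeasurableSet {w : (Y × α) × α | w.2 = w.1.2} :=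
    measurableSet_eq_fun measurable_snd (measurable_snd.comp measurable_fst)
  exact Kernel.measurable_kernel_prodMk_left_of_finite (κ := κ) ht fun z => hfin z.1

/-- The two orientations of an unordered pair. -/
def orientations : Sym2 α → Measure (α × α) :=
  Sym2.lift ⟨fun x y => Measure.dirac (x, y) + Measure.dirac (y, x), fun _ _ => add_comm _ _⟩

@[simp]
lemma orientations_mk (x y : α) :
    orientations s(x, y) = Measure.dirac (x, y) + Measure.dirac (y, x) := rfl

lemma measurable_orientations : Measurable (orientations (α := α)) := by
  have h : Measurable fun z : α × α => Measure.dirac (z.1, z.2) + Measure.dirac (z.2, z.1) := by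
    refine Measure.measurable_of_measurable_coe _ fun S hS => ?_
    simp only [Measure.add_apply, Measure.dirac_apply' _ hS]
    exact (measurable_one.indicator hS).add ((measurable_one.indicator hS).comp measurable_swap)
  -- Unordered pairs carry the quotient σ-algebra, so measurability is tested after the quotient
  -- map.
  exact fun S hS => h hS

/-- The measure on ordered pairs that counts both orientations of each unordered pair. -/
def orient (m : Measure (Sym2 α)) : Measure (α × α) := m.bind orientations

lemma measurable_orient : Measurable (orient (α := α)) :=
  Measure.measurable_bind' measurable_orientations

lemma orient_apply_eq_lintegral (m : Measure (Sym2 α)) {S : Set (α × α)} (hS : MeasurableSet S) :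
    orient m S = ∫⁻ e, orientations e S ∂m :=
  Measure.bind_apply hS measurable_orientations.aemeasurable

lemma measurable_sym2_map {τ : α → α} (hτ : Measurable τ) : Measurable (Sym2.map τ) := by
  have h : Measurable fun z : α × α => s(τ z.1, τ z.2) :=
    measurable_quot_mk.comp ((hτ.comp measurable_fst).prodMk (hτ.comp measurable_snd))
  exact fun S hS => h hS

lemma orient_map (m : Measure (Sym2 α)) {τ : α → α} (hτ : Measurable τ) :
    orient (m.map (Sym2.map τ)) = (orient m).map (Prod.map τ τ) := by
  have hττ : Measurable (Prod.map τ τ) := hτ.prodMap hτ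
  ext S hS
  have hmeas : Measurable fun e : Sym2 α => orientations e S :=
    (Measure.measurable_coe hS).comp measurable_orientations
  rw [Measure.map_apply hττ hS, orient_apply_eq_lintegral _ hS,
    orient_apply_eq_lintegral _ (hττ hS), lintegral_map hmeas (measurable_sym2_map hτ)]
  refine lintegral_congr fun e => ?_
  induction e with | _ x y
  simp only [Sym2.map_mk, orientations_mk, Measure.add_apply, Measure.dirac_apply' _ hS,
    Measure.dirac_apply' _ (hττ hS)]
  rfl

/-- Counts ordered pairs by sorting them over their unordered edge. Without loops the two
orientations differ, so no pair is counted twice. -/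
lemma orient_apply {m : Measure (Sym2 α)} (hm : IsSimplePointMeasure m)
    (hl : ∀ e ∈ pointSet m, ¬ e.IsDiag) {S : Set (α × α)} (hS : MeasurableSet S) :
    orient m S = ((({z | z ∈ S ∧ s(z.1, z.2) ∈ pointSet m}).encard : ℕ∞) : ℝ≥0∞) := by
  set A := {z : α × α | z ∈ S ∧ s(z.1, z.2) ∈ pointSet m} with hA
  have hmeas : Measurable fun e => orientations e S :=
    (Measure.measurable_coe hS).comp measurable_orientations
  rw [orient_apply_eq_lintegral _ hS]
  conv_lhs => rw [hm.2]
  rw [lintegral_sum_measure]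
  simp only [lintegral_dirac' _ hmeas]
  rw [tsum_subtype (pointSet m) (fun e => orientations e S),
    ← tsum_encard_fiber A fun z : α × α => s(z.1, z.2)]
  refine tsum_congr fun e => ?_
  by_cases he : e ∈ pointSet m
  · rw [Set.indicator_of_mem he]
    induction e with | _ x y
    have hxy : x ≠ y := fun h => hl _ he (by simpa using h)
    have hfib : A ∩ (fun z : α × α => s(z.1, z.2)) ⁻¹' {s(x, y)} =
        ({(x, y)} ∩ S) ∪ ({(y, x)} ∩ S) := by
      ext ⟨a, b⟩
      simp only [hA, Set.mem_inter_iff, Set.mem_ofPred_eq, Set.mem_preimage, Set.mem_singleton_iff,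
        Set.mem_union, Sym2.eq_iff, Prod.mk.injEq]
      constructor
      · rintro ⟨⟨h1, _⟩, ⟨rfl, rfl⟩ | ⟨rfl, rfl⟩⟩ <;> simp [h1]
      · rintro (⟨⟨rfl, rfl⟩, h⟩ | ⟨⟨rfl, rfl⟩, h⟩)
        · exact ⟨⟨h, he⟩, by simp⟩
        · exact ⟨⟨h, by rwa [Sym2.eq_swap]⟩, by simp⟩
    have hdisj : Disjoint ({(x, y)} ∩ S) ({(y, x)} ∩ S) := by
      refine Disjoint.mono Set.inter_subset_left Set.inter_subset_left ?_
      simp [hxy]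
    have hone : ∀ z : α × α, ((({z} ∩ S).encard : ℕ∞) : ℝ≥0∞) = S.indicator 1 z := by
      intro z
      by_cases hz : z ∈ S
      · rw [Set.inter_eq_left.2 (Set.singleton_subset_iff.2 hz)]
        simp [hz]
      · rw [Set.singleton_inter_eq_empty.2 hz]
        simp [hz]
    rw [hfib, Set.encard_union_eq hdisj, ENat.toENNReal_add, hone, hone, orientations_mk,
      Measure.add_apply, Measure.dirac_apply' _ hS, Measure.dirac_apply' _ hS]
  · rw [Set.indicator_of_notMem he]
    have : A ∩ (fun z : α × α => s(z.1, z.2)) ⁻¹' {e} = ∅ := by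
      ext z
      simp only [hA, Set.mem_inter_iff, Set.mem_ofPred_eq, Set.mem_preimage, Set.mem_singleton_iff,
        Set.mem_empty_iff_false, iff_false]
      rintro ⟨⟨_, h⟩, rfl⟩
      exact he h
    simp [this]

end PointMeasures

/-! ### Counting matched pairs by lattice cube. -/

section MatchedPairs

variable {d : ℕ}

/-- The measure counting ordered pairs `(x, y)` such that `x` is an atom of `r` of unit mass
in the lattice cube of index `p` and `{x, y}` is an atom of `m`. -/
def matchedPairs (p : Fin d → ℤ) (z : Measure (Space d) × Measure (Sym2 (Space d))) :
    Measure (Space d × Space d) :=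
  (finPart (Prod.fst ⁻¹' cell p) (orient z.2)).restrict {w | finPart (cell p) z.1 {w.1} = 1}

lemma measurableSet_fst_preimage_cell (p : Fin d → ℤ) :
    MeasurableSet (Prod.fst ⁻¹' cell p : Set (Space d × Space d)) :=
  measurable_fst (measurableSet_cell p)

lemma measurableSet_atom (p : Fin d → ℤ) (r : Measure (Space d)) :
    MeasurableSet {w : Space d × Space d | finPart (cell p) r {w.1} = 1} := by
  have h := measurable_atom (α := Space d) (Y := Unit) (N := fun _ => finPart (cell p) r)
    measurable_const fun _ => inferInstance
  exact (h.comp (measurable_const (a := ()) |>.prodMk measurable_fst)) (measurableSet_singleton 1)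

lemma measurable_matchedPairs (p : Fin d → ℤ) : Measurable (matchedPairs p) := by
  refine Measure.measurable_of_measurable_coe _ fun S hS => ?_
  let κ : Kernel (Measure (Space d) × Measure (Sym2 (Space d))) (Space d × Space d) :=
    ⟨fun z => finPart (Prod.fst ⁻¹' cell p) (orient z.2),
      (measurable_finPart (measurableSet_fst_preimage_cell p)).comp
        (measurable_orient.comp measurable_snd)⟩
  have hat : Measurable fun w : (Measure (Space d) × Measure (Sym2 (Space d))) ×
      (Space d × Space d) => finPart (cell p) w.1.1 {w.2.1} :=
    (measurable_atom (measurable_finPart (measurableSet_cell p)) fun r => inferInstance).comp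
      ((measurable_fst.comp measurable_fst).prodMk (measurable_fst.comp measurable_snd))
  have ht : MeasurableSet {w : (Measure (Space d) × Measure (Sym2 (Space d))) ×
      (Space d × Space d) | w.2 ∈ S ∧ finPart (cell p) w.1.1 {w.2.1} = 1} :=
    (measurable_snd hS).inter (hat (measurableSet_singleton 1))
  have h := Kernel.measurable_kernel_prodMk_left_of_finite (κ := κ) ht
    fun z => inferInstanceAs (IsFiniteMeasure (finPart _ _))
  convert h using 1
  funext z
  rw [matchedPairs, Measure.restrict_apply hS]
  rfl

lemma matchedPairs_shift (p q v : Fin d → ℤ) (r : Measure (Space d))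
    (m : Measure (Sym2 (Space d))) :
    matchedPairs p (r.map (shift v), m.map (Sym2.map (shift v))) {w | w.2 ∈ cell q} =
      matchedPairs (p - v) (r, m) {w | w.2 ∈ cell (q - v)} := by
  have hs := measurable_shift v
  have hss : Measurable (Prod.map (shift v) (shift v)) := hs.prodMap hs
  have hq : ∀ q : Fin d → ℤ, MeasurableSet {w : Space d × Space d | w.2 ∈ cell q} :=
    fun q => measurable_snd (measurableSet_cell q)
  have hpre : (Prod.map (shift v) (shift v)) ⁻¹' (Prod.fst ⁻¹' cell p) =
      Prod.fst ⁻¹' cell (p - v) := by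
    rw [← shift_preimage_cell]
    rfl
  unfold matchedPairs
  simp only
  rw [orient_map _ hs, finPart_map (measurableSet_fst_preimage_cell p) _ hss,
    finPart_map (measurableSet_cell p) _ hs, shift_preimage_cell, hpre, Measure.restrict_apply (hq q),
    Measure.restrict_apply (hq _)]
  have hat : {w : Space d × Space d |
      (finPart (cell (p - v)) r).map (shift v) {w.1} = 1} =
      {w | finPart (cell p) (r.map (shift v)) {w.1} = 1} := by
    rw [finPart_map (measurableSet_cell p) _ hs, shift_preimage_cell]
  rw [Measure.map_apply hss ((hq q).inter (hat ▸ measurableSet_atom p _))]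
  congr 1
  ext w
  simp only [Set.mem_preimage, Set.mem_inter_iff, Set.mem_ofPred_eq, Prod.map_fst, Prod.map_snd]
  rw [Measure.map_apply hs (measurableSet_singleton _), ← Set.image_singleton,
    (shift_injective v).preimage_image]
  have hwq : w.2 ∈ cell (q - v) ↔ shift v w.2 ∈ cell q := by
    rw [← shift_preimage_cell, Set.mem_preimage]
  rw [hwq]

/-- A configuration of red points, blue points and edges forming a perfect matching. -/
structure IsGood (r b : Measure (Space d)) (m : Measure (Sym2 (Space d))) : Prop where
  red_simple : IsSimplePointMeasure r
  blue_simple : IsSimplePointMeasure b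
  edge_simple : IsSimplePointMeasure m
  red_finite : ∀ A : Set (Space d), Bornology.IsBounded A → (pointSet r ∩ A).Finite
  blue_finite : ∀ A : Set (Space d), Bornology.IsBounded A → (pointSet b ∩ A).Finite
  matching : IsPerfectBipartiteMatching (pointSet r) (pointSet b) (pointSet m)
  disjoint : Disjoint (pointSet r) (pointSet b)

namespace IsGood

variable {r b : Measure (Space d)} {m : Measure (Sym2 (Space d))}

lemma red_cell_lt_top (h : IsGood r b m) (p : Fin d → ℤ) : r (cell p) < ∞ := by
  rw [h.red_simple.apply (measurableSet_cell p)]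
  simpa using (h.red_finite _ (isBounded_cell p)).encard_lt_top

lemma mem_union (h : IsGood r b m) {x y : Space d} (hxy : s(x, y) ∈ pointSet m) :
    x ∈ pointSet r ∪ pointSet b := by
  obtain ⟨u, hu, v, hv, huv⟩ := h.matching.bipartite _ hxy
  rcases Sym2.eq_iff.1 huv with ⟨rfl, rfl⟩ | ⟨rfl, rfl⟩
  · exact Or.inl hu
  · exact Or.inr hv

lemma partner_unique (h : IsGood r b m) {x y y' : Space d} (hxy : s(x, y) ∈ pointSet m)
    (hxy' : s(x, y') ∈ pointSet m) : y = y' := by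
  have := (h.matching.degree_one x (h.mem_union hxy)).unique ⟨hxy, Sym2.mem_mk_left _ _⟩
    ⟨hxy', Sym2.mem_mk_left _ _⟩
  exact Sym2.congr_right.1 this

lemma injOn_fst (h : IsGood r b m) :
    Set.InjOn Prod.fst {z : Space d × Space d | s(z.1, z.2) ∈ pointSet m} := by
  rintro ⟨x, y⟩ hz ⟨x', y'⟩ hz' (rfl : x = x')
  exact Prod.ext rfl (h.partner_unique hz hz')

lemma injOn_snd (h : IsGood r b m) :
    Set.InjOn Prod.snd {z : Space d × Space d | s(z.1, z.2) ∈ pointSet m} := by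
  rintro ⟨x, y⟩ hz ⟨x', y'⟩ hz' (rfl : y = y')
  simp only [Set.mem_ofPred_eq] at hz hz'
  rw [Sym2.eq_swap] at hz hz'
  exact Prod.ext (h.partner_unique hz hz') rfl

lemma exists_partner (h : IsGood r b m) {x : Space d} (hx : x ∈ pointSet r ∪ pointSet b) :
    ∃ y, s(x, y) ∈ pointSet m := by
  obtain ⟨e, ⟨he, hxe⟩, _⟩ := h.matching.degree_one x hx
  obtain ⟨y, rfl⟩ := hxe
  exact ⟨y, he⟩

/-- Edges are unordered, so the colour of the partner is determined only because no point has both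
colours. -/
lemma mem_blue (h : IsGood r b m) {x y : Space d} (hx : x ∈ pointSet r)
    (hxy : s(x, y) ∈ pointSet m) : y ∈ pointSet b := by
  obtain ⟨u, hu, v, hv, huv⟩ := h.matching.bipartite _ hxy
  rcases Sym2.eq_iff.1 huv with ⟨rfl, rfl⟩ | ⟨rfl, rfl⟩
  · exact hv
  · exact absurd hv (Set.disjoint_left.1 h.disjoint hx)

lemma mem_red (h : IsGood r b m) {x y : Space d} (hy : y ∈ pointSet b)
    (hxy : s(x, y) ∈ pointSet m) : x ∈ pointSet r := by
  obtain ⟨u, hu, v, hv, huv⟩ := h.matching.bipartite _ hxy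
  rcases Sym2.eq_iff.1 huv with ⟨rfl, rfl⟩ | ⟨rfl, rfl⟩
  · exact hu
  · exact absurd hy (Set.disjoint_left.1 h.disjoint hu)

lemma orient_lt_top (h : IsGood r b m) (p : Fin d → ℤ) :
    orient m (Prod.fst ⁻¹' cell p) < ∞ := by
  rw [orient_apply h.edge_simple h.matching.loopless (measurableSet_fst_preimage_cell p)]
  have hfin : {z : Space d × Space d | z ∈ Prod.fst ⁻¹' cell p ∧ s(z.1, z.2) ∈ pointSet m}.Finite := by
    refine Set.Finite.of_finite_image ?_ (h.injOn_fst.mono fun z hz => hz.2)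
    refine ((h.red_finite _ (isBounded_cell p)).union
      (h.blue_finite _ (isBounded_cell p))).subset ?_
    rintro _ ⟨z, ⟨hz, hzm⟩, rfl⟩
    rw [← Set.union_inter_distrib_right]
    exact ⟨h.mem_union hzm, hz⟩
  simpa using hfin.encard_lt_top

lemma matchedPairs_apply (h : IsGood r b m) (p : Fin d → ℤ) {S : Set (Space d × Space d)}
    (hS : MeasurableSet S) : matchedPairs p (r, m) S =
      ((({z | z ∈ S ∧ s(z.1, z.2) ∈ pointSet m} ∩
        {z | z.1 ∈ pointSet r ∩ cell p}).encard : ℕ∞) : ℝ≥0∞) := by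
  have hat : ∀ x, finPart (cell p) r {x} = 1 ↔ x ∈ pointSet r ∩ cell p := by
    intro x
    rw [finPart, if_pos (h.red_cell_lt_top p), Measure.restrict_apply (measurableSet_singleton x)]
    by_cases hx : x ∈ cell p
    · rw [Set.inter_eq_left.2 (Set.singleton_subset_iff.2 hx)]
      simp [hx, pointSet]
    · rw [Set.singleton_inter_eq_empty.2 hx]
      simp [hx]
  have hS' := hS.inter (measurableSet_atom p r)
  rw [matchedPairs, Measure.restrict_apply hS, finPart, if_pos (h.orient_lt_top p),
    Measure.restrict_apply hS', orient_apply h.edge_simple h.matching.loopless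
      (hS'.inter (measurableSet_fst_preimage_cell p))]
  congr 2
  ext z
  simp only [Set.mem_inter_iff, Set.mem_ofPred_eq, hat, Set.mem_preimage]
  tauto

/-- The first coordinate is a bijection from the counted pairs to the red points of the cube. -/
lemma matchedPairs_univ (h : IsGood r b m) (p : Fin d → ℤ) :
    matchedPairs p (r, m) Set.univ = r (cell p) := by
  rw [h.matchedPairs_apply p MeasurableSet.univ, h.red_simple.apply (measurableSet_cell p)]
  congr 1
  rw [← (h.injOn_fst.mono fun z hz => hz.1.2).encard_image]
  congr 1
  ext x
  constructor
  · rintro ⟨z, hz, rfl⟩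
    exact hz.2
  · intro hx
    obtain ⟨y, hy⟩ := h.exists_partner (Or.inl hx.1)
    exact ⟨(x, y), ⟨⟨trivial, hy⟩, hx⟩, rfl⟩

/-- Each blue point of the cube has one red partner, and the sum sorts blue points by the cube of
that partner. -/
lemma tsum_matchedPairs (h : IsGood r b m) (q : Fin d → ℤ) :
    ∑' p, matchedPairs p (r, m) {z | z.2 ∈ cell q} = b (cell q) := by
  have hq : MeasurableSet {z : Space d × Space d | z.2 ∈ cell q} :=
    measurable_snd (measurableSet_cell q)
  have h1 : ∀ p, matchedPairs p (r, m) {z | z.2 ∈ cell q} =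
      ((({z : Space d × Space d | z.2 ∈ cell q ∧ s(z.1, z.2) ∈ pointSet m ∧ z.1 ∈ pointSet r} ∩
        (fun z => cellIndex z.1) ⁻¹' {p}).encard : ℕ∞) : ℝ≥0∞) := by
    intro p
    rw [h.matchedPairs_apply p hq]
    congr 2
    ext z
    simp only [cell, Set.mem_inter_iff, Set.mem_ofPred_eq, Set.mem_preimage]
    tauto
  simp only [h1]
  rw [tsum_encard_fiber, h.blue_simple.apply (measurableSet_cell q)]
  congr 1
  rw [← (h.injOn_snd.mono fun z hz => hz.2.1).encard_image]
  congr 1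
  ext y
  constructor
  · rintro ⟨z, hz, rfl⟩
    exact ⟨h.mem_blue hz.2.2 hz.2.1, hz.1⟩
  · intro hy
    obtain ⟨x, hx⟩ := h.exists_partner (Or.inr hy.1)
    rw [Sym2.eq_swap] at hx
    exact ⟨(x, y), ⟨hy.2, hx, h.mem_red hy.1 hx⟩, rfl⟩

lemma encard_short_edges (h : IsGood r b m) (s : ℝ≥0) :
    ((({x | x ∈ pointSet r ∩ unitCube d ∧
      ∃ y, s(x, y) ∈ pointSet m ∧ ‖x - y‖ ≤ s}).encard : ℕ∞) : ℝ≥0∞) =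
      matchedPairs 0 (r, m) {z | ‖z.1 - z.2‖₊ ≤ s} := by
  rw [h.matchedPairs_apply 0 (measurableSet_le (by fun_prop) measurable_const)]
  congr 1
  rw [← (h.injOn_fst.mono fun z hz => hz.1.2).encard_image, unitCube_eq_cell]
  congr 1
  ext x
  constructor
  · rintro ⟨hx, y, hy, hxy⟩
    exact ⟨(x, y), ⟨⟨hxy, hy⟩, hx⟩, rfl⟩
  · rintro ⟨z, hz, rfl⟩
    exact ⟨hz.2, z.2, hz.1.2, hz.1.1⟩

end IsGood

lemma tsum_matchedPairs_snd (p : Fin d → ℤ) (z : Measure (Space d) × Measure (Sym2 (Space d))) :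
    ∑' q, matchedPairs p z {w | w.2 ∈ cell q} = matchedPairs p z Set.univ := by
  have hm : Measurable fun w : Space d × Space d => cellIndex w.2 :=
    measurable_cellIndex.comp measurable_snd
  have h := tsum_measure_preimage_singleton (μ := matchedPairs p z)
    (f := fun w : Space d × Space d => cellIndex w.2) (s := Set.univ) Set.countable_univ
    fun q _ => hm (measurableSet_singleton q)
  rw [Set.preimage_univ] at h
  rw [← h, tsum_univ (fun q => matchedPairs p z ((fun w => cellIndex w.2) ⁻¹' {q}))]
  rfl

end MatchedPairs

variable {d : ℕ} {Ω : Type*} [MeasurableSpace Ω] {P : Measure Ω}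

/-! ### Red and blue points are almost surely distinct. -/

section Disjointness

/-- The number of atoms of `z.1` in a lattice cube that are unit atoms of `z.2`. -/
def commonAtoms (p : Fin d → ℤ) (z : Measure (Space d) × Measure (Space d)) : ℝ≥0∞ :=
  finPart (cell p) z.1 {x | finPart (cell p) z.2 {x} = 1}

lemma measurable_commonAtoms (p : Fin d → ℤ) : Measurable (commonAtoms p) := by
  let κ : Kernel (Measure (Space d) × Measure (Space d)) (Space d) :=
    ⟨fun z => finPart (cell p) z.1,
      (measurable_finPart (measurableSet_cell p)).comp measurable_fst⟩
  have hat : Measurable fun w : (Measure (Space d) × Measure (Space d)) × Space d =>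
      finPart (cell p) w.1.2 {w.2} :=
    (measurable_atom (measurable_finPart (measurableSet_cell p)) fun r => inferInstance).comp
      ((measurable_snd.comp measurable_fst).prodMk measurable_snd)
  exact Kernel.measurable_kernel_prodMk_left_of_finite (κ := κ) (hat (measurableSet_singleton 1))
    fun z => inferInstanceAs (IsFiniteMeasure (finPart _ _))

lemma finPart_apply_le {α : Type*} [MeasurableSpace α] (W : Set α) (m : Measure α) {S : Set α}
    (hS : MeasurableSet S) : finPart W m S ≤ m (S ∩ W) := by
  unfold finPart
  split_ifs
  · rw [Measure.restrict_apply hS]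
  · simp

lemma ae_mem_finPart {α : Type*} [MeasurableSpace α] {W : Set α} (hW : MeasurableSet W)
    (m : Measure α) : ∀ᵐ x ∂finPart W m, x ∈ W := by
  unfold finPart
  split_ifs
  · exact ae_restrict_mem hW
  · simp

lemma countable_unit_atoms {α : Type*} [MeasurableSpace α] [MeasurableSingletonClass α]
    (m : Measure α) [IsFiniteMeasure m] : {x | m {x} = 1}.Countable := by
  refine (Measure.countable_meas_level_set_pos (μ := m) (g := id) measurable_id).mono ?_
  intro x hx
  have : {a : α | id a = x} = {x} := by
    ext
    simp
  simp only [Set.mem_ofPred_eq] at hx ⊢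
  rw [this, hx]
  exact one_pos

/-- With the blue configuration frozen, its atoms in a cube form a countable set, which is Lebesgue
null since `d > 0`. Independence and Tonelli then randomise it in `ae_commonAtoms_eq_zero`. -/
lemma lintegral_commonAtoms_eq_zero (hd : 0 < d) {R : Ω → Measure (Space d)} (hR : IsPoissonProcess 1 R P)
    (p : Fin d → ℤ) (b : Measure (Space d)) : ∫⁻ ω, commonAtoms p (R ω, b) ∂P = 0 := by
  have hc := countable_unit_atoms (finPart (cell p) b)
  have hm := hc.measurableSet
  rw [← nonpos_iff_eq_zero]
  calc ∫⁻ ω, commonAtoms p (R ω, b) ∂P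
      ≤ ∫⁻ ω, R ω ({x | finPart (cell p) b {x} = 1} ∩ cell p) ∂P :=
        lintegral_mono fun ω => finPart_apply_le _ _ hm
    _ = volume ({x | finPart (cell p) b {x} = 1} ∩ cell p) :=
        lintegral_count hR (hm.inter (measurableSet_cell p))
          ((isBounded_cell p).subset Set.inter_subset_right)
    _ ≤ 0 := by
        have : Nonempty (Fin d) := ⟨⟨0, hd⟩⟩
        exact ((hc.mono Set.inter_subset_left).measure_zero _).le

lemma ae_commonAtoms_eq_zero [IsProbabilityMeasure P] (hd : 0 < d) {R B : Ω → Measure (Space d)}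
    (hR : IsPoissonProcess 1 R P)
    (hB : IsPoissonProcess 1 B P) (hRB : IndepFun R B P) (p : Fin d → ℤ) :
    ∀ᵐ ω ∂P, commonAtoms p (R ω, B ω) = 0 := by
  have hRm := hR.isSimplePointProcess.measurable
  have hBm := hB.isSimplePointProcess.measurable
  have hmeas := measurable_commonAtoms p
  have : IsProbabilityMeasure (P.map R) := Measure.isProbabilityMeasure_map hRm.aemeasurable
  have : IsProbabilityMeasure (P.map B) := Measure.isProbabilityMeasure_map hBm.aemeasurable
  refine (lintegral_eq_zero_iff (hmeas.comp (hRm.prodMk hBm))).1 ?_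
  simp only [Function.comp_apply]
  calc ∫⁻ ω, commonAtoms p (R ω, B ω) ∂P
      = ∫⁻ z, commonAtoms p z ∂(P.map fun ω => (R ω, B ω)) := by
        rw [lintegral_map hmeas (hRm.prodMk hBm)]
    _ = ∫⁻ z, commonAtoms p z ∂((P.map R).prod (P.map B)) := by
        rw [(indepFun_iff_map_prod_eq_prod_map_map hRm.aemeasurable hBm.aemeasurable).1 hRB]
    _ = ∫⁻ b, ∫⁻ r, commonAtoms p (r, b) ∂(P.map R) ∂(P.map B) :=
        lintegral_prod_symm _ hmeas.aemeasurable
    _ = 0 := by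
        rw [lintegral_eq_zero_iff']
        · refine Eventually.of_forall fun b => ?_
          simp only [Pi.zero_apply]
          have hb : Measurable fun r => commonAtoms p (r, b) :=
            hmeas.comp (measurable_id.prodMk measurable_const)
          rw [lintegral_map hb hRm]
          exact lintegral_commonAtoms_eq_zero hd hR p b
        · exact hmeas.lintegral_prod_left'.aemeasurable

lemma ae_isGood [IsProbabilityMeasure P] (hd : 0 < d) {R B : Ω → Measure (Space d)}
    {M : Ω → Measure (Sym2 (Space d))} (hR : IsPoissonProcess 1 R P)
    (hB : IsPoissonProcess 1 B P) (hRB : IndepFun R B P)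
    (hM : IsTwoColorMatchingScheme R B M P) : ∀ᵐ ω ∂P, IsGood (R ω) (B ω) (M ω) := by
  have h0 : ∀ᵐ ω ∂P, ∀ p, commonAtoms p (R ω, B ω) = 0 :=
    ae_all_iff.2 fun p => ae_commonAtoms_eq_zero hd hR hB hRB p
  filter_upwards [hR.isSimplePointProcess.simple, hR.isSimplePointProcess.locallyFinite,
    hB.isSimplePointProcess.simple, hB.isSimplePointProcess.locallyFinite, hM.simple, hM.matching,
    h0] with ω hr hrf hb hbf hm hmat hc
  refine ⟨hr, hb, hm, hrf, hbf, hmat, ?_⟩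
  rw [Set.disjoint_left]
  intro x hxr hxb
  have hx : x ∈ cell (cellIndex x) := rfl
  have hone : ∀ m : Measure (Space d), IsSimplePointMeasure m →
      (∀ A : Set (Space d), Bornology.IsBounded A → (pointSet m ∩ A).Finite) → m {x} = 1 →
      finPart (cell (cellIndex x)) m {x} = 1 := by
    intro m hm hmf hmx
    have hlt : m (cell (cellIndex x)) < ∞ := by
      rw [hm.apply (measurableSet_cell _)]
      simpa using (hmf _ (isBounded_cell _)).encard_lt_top
    rw [finPart, if_pos hlt, Measure.restrict_apply (measurableSet_singleton x),
      Set.inter_eq_left.2 (Set.singleton_subset_iff.2 hx), hmx]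
  have h1 : (1 : ℝ≥0∞) ≤ commonAtoms (cellIndex x) (R ω, B ω) := by
    rw [← hone (R ω) hr hrf hxr]
    exact measure_mono (Set.singleton_subset_iff.2 (hone (B ω) hb hbf hxb))
  rw [hc] at h1
  exact absurd h1 (by simp)

end Disjointness

/-! ### The law of the typical distance and its moments. -/

section TypicalDistance

/-- The length of an edge. -/
def edgeLength (z : Space d × Space d) : ℝ≥0 := ‖z.1 - z.2‖₊

lemma measurable_edgeLength : Measurable (edgeLength (d := d)) := by
  unfold edgeLength
  fun_prop

/-- The law of the distance from a typical red point to its partner. -/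
def typicalDistance (R : Ω → Measure (Space d)) (M : Ω → Measure (Sym2 (Space d)))
    (P : Measure Ω) : Measure ℝ≥0 :=
  P.bind fun ω => (matchedPairs 0 (R ω, M ω)).map edgeLength

variable {R B : Ω → Measure (Space d)} {M : Ω → Measure (Sym2 (Space d))}

lemma measurable_matchedPairs_comp (hR : Measurable R) (hM : Measurable M) (p : Fin d → ℤ) :
    Measurable fun ω => matchedPairs p (R ω, M ω) :=
  (measurable_matchedPairs p).comp (hR.prodMk hM)

lemma lintegral_typicalDistance (hR : Measurable R) (hM : Measurable M) {f : ℝ≥0 → ℝ≥0∞}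
    (hf : Measurable f) : ∫⁻ t, f t ∂typicalDistance R M P =
      ∫⁻ ω, ∫⁻ z, f (edgeLength z) ∂matchedPairs 0 (R ω, M ω) ∂P := by
  have hm : Measurable fun ω => (matchedPairs 0 (R ω, M ω)).map edgeLength :=
    (Measure.measurable_map _ measurable_edgeLength).comp
      (measurable_matchedPairs_comp hR hM (0 : Fin d → ℤ))
  unfold typicalDistance
  rw [Measure.lintegral_bind hm.aemeasurable hf.aemeasurable]
  refine lintegral_congr fun ω => ?_
  rw [lintegral_map hf measurable_edgeLength]

lemma typicalDistance_apply (hR : Measurable R) (hM : Measurable M) {S : Set ℝ≥0}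
    (hS : MeasurableSet S) : typicalDistance R M P S =
      ∫⁻ ω, matchedPairs 0 (R ω, M ω) (edgeLength ⁻¹' S) ∂P := by
  have hm : Measurable fun ω => (matchedPairs 0 (R ω, M ω)).map edgeLength :=
    (Measure.measurable_map _ measurable_edgeLength).comp
      (measurable_matchedPairs_comp hR hM (0 : Fin d → ℤ))
  unfold typicalDistance
  rw [Measure.bind_apply hS hm.aemeasurable]
  refine lintegral_congr fun ω => ?_
  rw [Measure.map_apply measurable_edgeLength hS]

lemma isProbabilityMeasure_typicalDistance (hR : IsPoissonProcess 1 R P) (hM : Measurable M)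
    (hgood : ∀ᵐ ω ∂P, IsGood (R ω) (B ω) (M ω)) :
    IsProbabilityMeasure (typicalDistance R M P) := by
  constructor
  rw [typicalDistance_apply hR.isSimplePointProcess.measurable hM MeasurableSet.univ]
  have h : ∀ᵐ ω ∂P, matchedPairs 0 (R ω, M ω) (edgeLength ⁻¹' Set.univ) = R ω (cell 0) := by
    filter_upwards [hgood] with ω h
    rw [Set.preimage_univ, h.matchedPairs_univ]
  rw [lintegral_congr_ae h, lintegral_count hR (measurableSet_cell 0) (isBounded_cell 0),
    volume_cell]

lemma typicalDistance_Iic (hR : Measurable R) (hM : Measurable M)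
    (hgood : ∀ᵐ ω ∂P, IsGood (R ω) (B ω) (M ω)) (r : ℝ≥0) :
    typicalDistance R M P (Set.Iic r) = matchingDistribution R M P r := by
  rw [typicalDistance_apply hR hM measurableSet_Iic, matchingDistribution]
  refine lintegral_congr_ae ?_
  filter_upwards [hgood] with ω h
  exact (h.encard_short_edges r).symm

/-- The expected number of red points in the lattice cube `0` with partner in the cube `v`. -/
def flow (R : Ω → Measure (Space d)) (M : Ω → Measure (Sym2 (Space d)))
    (P : Measure Ω) (v : Fin d → ℤ) : ℝ≥0∞ :=
  ∫⁻ ω, matchedPairs 0 (R ω, M ω) {w | w.2 ∈ cell v} ∂P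

/-- Pairs are split by the cube of the partner, where `|v i|` is at most the edge length plus one;
`t ↦ t ^ s` is subadditive for `0 ≤ s ≤ 1`. -/
lemma tsum_rpow_mul_matchedPairs_le (z : Measure (Space d) × Measure (Sym2 (Space d))) {s : ℝ}
    (hs0 : 0 ≤ s) (hs1 : s ≤ 1) (i : Fin d) :
    ∑' v : Fin d → ℤ, ‖(v i : ℝ)‖ₑ ^ s * matchedPairs 0 z {w | w.2 ∈ cell v} ≤
      ∫⁻ w, ((edgeLength w : ℝ≥0∞) ^ s + 1) ∂matchedPairs 0 z := by
  have hm : ∀ v : Fin d → ℤ, MeasurableSet {w : Space d × Space d | w.2 ∈ cell v} :=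
    fun v => measurable_snd (measurableSet_cell v)
  have hae : ∀ᵐ w ∂matchedPairs 0 z, w.1 ∈ cell (0 : Fin d → ℤ) :=
    ae_restrict_of_ae (ae_mem_finPart (measurableSet_fst_preimage_cell 0) _)
  have hun : (⋃ v : Fin d → ℤ, {w : Space d × Space d | w.2 ∈ cell v}) = Set.univ := by
    ext w
    simp [cell]
  rw [← setLIntegral_univ, ← hun, lintegral_iUnion hm]
  · refine ENNReal.tsum_le_tsum fun v => ?_
    rw [← setLIntegral_const]
    refine setLIntegral_mono_ae' (hm v) ?_
    filter_upwards [hae] with w hw hwv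
    have h1 : ‖(v i : ℝ)‖ₑ ≤ (edgeLength w : ℝ≥0∞) + 1 := by
      have := abs_le_norm_sub_add_one hw hwv i
      have h2 : ‖(v i : ℝ)‖₊ ≤ edgeLength w + 1 := by
        rw [← NNReal.coe_le_coe]
        simpa [edgeLength] using this
      rw [enorm_eq_nnnorm]
      exact_mod_cast h2
    refine (ENNReal.rpow_le_rpow h1 hs0).trans ?_
    refine (ENNReal.rpow_add_le_add_rpow _ _ hs0 hs1).trans ?_
    simp
  · intro v w hvw
    exact Disjoint.preimage _ (Disjoint.preimage _ (by simpa using hvw))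

lemma tsum_rpow_mul_flow_le (hR : Measurable R) (hM : Measurable M) {s : ℝ}
    (hs0 : 0 ≤ s) (hs1 : s ≤ 1) (i : Fin d) :
    ∑' v : Fin d → ℤ, ‖(v i : ℝ)‖ₑ ^ s * flow R M P v ≤
      ∫⁻ t, ((t : ℝ≥0∞) ^ s + 1) ∂typicalDistance R M P := by
  have hm : ∀ v : Fin d → ℤ, MeasurableSet {w : Space d × Space d | w.2 ∈ cell v} :=
    fun v => measurable_snd (measurableSet_cell v)
  have hmeas : ∀ v : Fin d → ℤ,
      Measurable fun ω => matchedPairs 0 (R ω, M ω) {w | w.2 ∈ cell v} := fun v =>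
    (Measure.measurable_coe (hm v)).comp (measurable_matchedPairs_comp hR hM _)
  rw [lintegral_typicalDistance hR hM (by fun_prop)]
  simp only [flow]
  simp_rw [← lintegral_const_mul _ (hmeas _)]
  rw [← lintegral_tsum fun v => ((hmeas v).const_mul _).aemeasurable]
  exact lintegral_mono fun ω => tsum_rpow_mul_matchedPairs_le _ hs0 hs1 i

end TypicalDistance

/-! ### Extended nonnegative functions as elements of `L¹`. -/

section ToL1

variable {Y : Type*} [MeasurableSpace Y] {Q : Measure Y}

/-- The class in `L¹` of a nonnegative function with finite integral. -/
def toL1 (Q : Measure Y) (g : Y → ℝ≥0∞) : Lp ℝ 1 Q :=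
  open Classical in if h : Integrable (fun y => (g y).toReal) Q then h.toL1 _ else 0

variable {g h : Y → ℝ≥0∞}

lemma coeFn_toL1 (hg : Measurable g) (hfin : ∫⁻ y, g y ∂Q ≠ ∞) :
    toL1 Q g =ᵐ[Q] fun y => (g y).toReal := by
  have hi := integrable_toReal_of_lintegral_ne_top hg.aemeasurable hfin
  rw [toL1, dif_pos hi]
  exact hi.coeFn_toL1

lemma toL1_congr (hgh : g =ᵐ[Q] h) : toL1 Q g = toL1 Q h := by
  have hr : (fun y => (g y).toReal) =ᵐ[Q] fun y => (h y).toReal := by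
    filter_upwards [hgh] with y hy
    rw [hy]
  unfold toL1
  by_cases hi : Integrable (fun y => (g y).toReal) Q
  · rw [dif_pos hi, dif_pos (hi.congr hr)]
    exact (Integrable.toL1_eq_toL1_iff _ _ _ _).2 hr
  · rw [dif_neg hi, dif_neg fun h => hi (h.congr hr.symm)]

lemma toL1_add (hg : Measurable g) (hgf : ∫⁻ y, g y ∂Q ≠ ∞) (hh : Measurable h)
    (hhf : ∫⁻ y, h y ∂Q ≠ ∞) : toL1 Q (fun y => g y + h y) = toL1 Q g + toL1 Q h := by
  have hf : ∫⁻ y, g y + h y ∂Q ≠ ∞ := by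
    rw [lintegral_add_left hg]
    exact ENNReal.add_ne_top.2 ⟨hgf, hhf⟩
  apply Lp.ext
  filter_upwards [coeFn_toL1 (hg.add hh) hf, coeFn_toL1 hg hgf, coeFn_toL1 hh hhf,
    Lp.coeFn_add (toL1 Q g) (toL1 Q h), ae_lt_top hg hgf, ae_lt_top hh hhf] with y h1 h2 h3 h4 h5 h6
  rw [h4, Pi.add_apply, h2, h3, ← ENNReal.toReal_add h5.ne h6.ne]
  exact h1

lemma toL1_sum {ι : Type*} (s : Finset ι) (g : ι → Y → ℝ≥0∞) (hg : ∀ i, Measurable (g i))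
    (hf : ∀ i, ∫⁻ y, g i y ∂Q ≠ ∞) :
    toL1 Q (fun y => ∑ i ∈ s, g i y) = ∑ i ∈ s, toL1 Q (g i) := by
  classical
  induction s using Finset.induction_on with
  | empty =>
    apply Lp.ext
    filter_upwards [coeFn_toL1 (Q := Q) (g := fun _ => 0) measurable_const (by simp),
      Lp.coeFn_zero ℝ 1 Q] with y h1 h2
    simp only [Finset.sum_empty]
    rw [h1, h2]
    simp
  | insert a s ha ih =>
    simp only [Finset.sum_insert ha]
    rw [toL1_add (hg a) (hf a) (Finset.measurable_fun_sum s fun i _ => hg i), ih]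
    rw [lintegral_finsetSum s fun i _ => hg i]
    exact ENNReal.sum_ne_top.2 fun i _ => hf i

lemma norm_toL1_sub (hg : Measurable g) (hgf : ∫⁻ y, g y ∂Q ≠ ∞) (hh : Measurable h)
    (hhf : ∫⁻ y, h y ∂Q ≠ ∞) :
    ‖toL1 Q g - toL1 Q h‖ = ∫ y, |(g y).toReal - (h y).toReal| ∂Q := by
  rw [L1.norm_eq_integral_norm]
  refine integral_congr_ae ?_
  filter_upwards [coeFn_toL1 hg hgf, coeFn_toL1 hh hhf, Lp.coeFn_sub (toL1 Q g) (toL1 Q h)]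
    with y h1 h2 h3
  rw [h3, Pi.sub_apply, h1, h2, Real.norm_eq_abs]

lemma norm_toL1 (hg : Measurable g) (hgf : ∫⁻ y, g y ∂Q ≠ ∞) :
    ‖toL1 Q g‖ = (∫⁻ y, g y ∂Q).toReal := by
  rw [L1.norm_eq_integral_norm, ← integral_toReal hg.aemeasurable (ae_lt_top hg hgf)]
  refine integral_congr_ae ?_
  filter_upwards [coeFn_toL1 hg hgf] with y h1
  rw [h1, Real.norm_of_nonneg ENNReal.toReal_nonneg]

lemma koopman_toL1 (τ : Y → Y) (hτ : MeasurePreserving τ Q Q) (hg : Measurable g)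
    (hgf : ∫⁻ y, g y ∂Q ≠ ∞) : koopman τ hτ (toL1 Q g) = toL1 Q (fun y => g (τ y)) := by
  have hf : ∫⁻ y, g (τ y) ∂Q ≠ ∞ := by rwa [hτ.lintegral_comp hg]
  apply Lp.ext
  filter_upwards [Lp.coeFn_compMeasurePreserving (toL1 Q g) hτ,
    hτ.quasiMeasurePreserving.ae (coeFn_toL1 hg hgf),
    coeFn_toL1 (hg.comp hτ.measurable) hf] with y h1 h2 h3
  exact (h1.trans h2).trans h3.symm

/-- For nonnegative functions the norm is the integral, so the distance to a partial sum is exactly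
the tail of a finite sum of integrals. -/
lemma hasSum_toL1 {ι : Type*} [Countable ι] (g : ι → Y → ℝ≥0∞) (G : Y → ℝ≥0∞)
    (hg : ∀ i, Measurable (g i)) (hGf : ∫⁻ y, G y ∂Q ≠ ∞)
    (hsum : ∀ᵐ y ∂Q, ∑' i, g i y = G y) : HasSum (fun i => toL1 Q (g i)) (toL1 Q G) := by
  have htot : ∑' i, ∫⁻ y, g i y ∂Q ≠ ∞ := by
    rw [← lintegral_tsum fun i => (hg i).aemeasurable]
    rwa [lintegral_congr_ae hsum]
  have hf : ∀ i, ∫⁻ y, g i y ∂Q ≠ ∞ := fun i => ENNReal.ne_top_of_tsum_ne_top htot i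
  have hkey : ∀ s : Finset ι, ‖(∑ i ∈ s, toL1 Q (g i)) - toL1 Q G‖ =
      (∑' i : {i // i ∉ s}, ∫⁻ y, g i y ∂Q).toReal := by
    intro s
    have hrm : Measurable fun y => ∑' i : {i // i ∉ s}, g i y :=
      Measurable.tsum fun i => hg i
    have hrint : ∫⁻ y, ∑' i : {i // i ∉ s}, g i y ∂Q = ∑' i : {i // i ∉ s}, ∫⁻ y, g i y ∂Q :=
      lintegral_tsum fun i => (hg i).aemeasurable
    have hrf : ∫⁻ y, ∑' i : {i // i ∉ s}, g i y ∂Q ≠ ∞ := by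
      rw [hrint]
      exact ne_top_of_le_ne_top htot (ENNReal.tsum_comp_le_tsum_of_injective
        Subtype.val_injective (fun i => ∫⁻ y, g i y ∂Q))
    have hdec : toL1 Q G = ∑ i ∈ s, toL1 Q (g i) + toL1 Q (fun y => ∑' i : {i // i ∉ s}, g i y) := by
      rw [← toL1_sum s g hg hf, ← toL1_add (Finset.measurable_fun_sum s fun i _ => hg i) _ hrm hrf]
      · refine toL1_congr ?_
        filter_upwards [hsum] with y hy
        rw [← hy]
        exact (ENNReal.sum_add_tsum_compl s fun i => g i y).symm
      · rw [lintegral_finsetSum s fun i _ => hg i]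
        exact ENNReal.sum_ne_top.2 fun i _ => hf i
    rw [hdec, sub_add_cancel_left, norm_neg, norm_toL1 hrm hrf, hrint]
  rw [HasSum, SummationFilter.unconditional_filter, tendsto_iff_norm_sub_tendsto_zero]
  simp only [hkey]
  have := (ENNReal.tendsto_toReal ENNReal.zero_ne_top).comp
    (ENNReal.tendsto_tsum_compl_atTop_zero htot)
  rwa [ENNReal.toReal_zero] at this

end ToL1

/-! ### The space of configurations and its translations. -/

section Configurations

variable {d : ℕ}

/-- Configurations of red points, blue points and edges. -/
abbrev Config (d : ℕ) : Type := Measure (Space d) × Measure (Space d) × Measure (Sym2 (Space d))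

/-- Translation of a configuration by minus an integer vector. -/
def translate (v : Fin d → ℤ) (y : Config d) : Config d :=
  (y.1.map (shift (-v)), y.2.1.map (shift (-v)), y.2.2.map (Sym2.map (shift (-v))))

lemma measurable_translate (v : Fin d → ℤ) : Measurable (translate v) := by
  have h1 := Measure.measurable_map _ (measurable_shift (-v))
  have h2 := Measure.measurable_map _ (measurable_sym2_map (measurable_shift (-v)))
  exact (h1.comp measurable_fst).prodMk
    ((h1.comp (measurable_fst.comp measurable_snd)).prodMk
      (h2.comp (measurable_snd.comp measurable_snd)))

lemma translate_zero : translate (0 : Fin d → ℤ) = id := by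
  funext y
  simp [translate, shift_zero]

lemma translate_translate (v w : Fin d → ℤ) (y : Config d) :
    translate w (translate v y) = translate (v + w) y := by
  have h : shift (-w) ∘ shift (-v) = (shift (-(v + w)) : Space d → Space d) := by
    funext x
    rw [Function.comp_apply, shift_shift, neg_add]
  have hs : Sym2.map (shift (-w)) ∘ Sym2.map (shift (-v)) =
      (Sym2.map (shift (-(v + w))) : Sym2 (Space d) → Sym2 (Space d)) := by
    rw [← Sym2.map_comp, h]
  unfold translate
  simp only
  rw [Measure.map_map (measurable_shift _) (measurable_shift _),
    Measure.map_map (measurable_shift _) (measurable_shift _),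
    Measure.map_map (measurable_sym2_map (measurable_shift _))
      (measurable_sym2_map (measurable_shift _)), h, hs]

/-- The number of edges from a red point in the cube `p` to a partner in the cube `q`. -/
def pairCount (p q : Fin d → ℤ) (y : Config d) : ℝ≥0∞ :=
  matchedPairs p (y.1, y.2.2) {w | w.2 ∈ cell q}

lemma measurable_pairCount (p q : Fin d → ℤ) : Measurable (pairCount p q) :=
  ((Measure.measurable_coe (measurable_snd (measurableSet_cell q))).comp
    (measurable_matchedPairs p)).comp
      (measurable_fst.prodMk (measurable_snd.comp measurable_snd))

/-- Moving the configuration by `-v` amounts to moving the observation cubes by `+v`; the sign in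
`translate` is chosen for this. -/
lemma pairCount_translate (p q v : Fin d → ℤ) (y : Config d) :
    pairCount p q (translate v y) = pairCount (p + v) (q + v) y := by
  rw [pairCount, translate, matchedPairs_shift, sub_neg_eq_add, sub_neg_eq_add, pairCount]

lemma red_translate (p v : Fin d → ℤ) (y : Config d) :
    (translate v y).1 (cell p) = y.1 (cell (p + v)) := by
  rw [translate, Measure.map_apply (measurable_shift _) (measurableSet_cell p),
    shift_preimage_cell, sub_neg_eq_add]

lemma blue_translate (p v : Fin d → ℤ) (y : Config d) :
    (translate v y).2.1 (cell p) = y.2.1 (cell (p + v)) := by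
  rw [translate, Measure.map_apply (measurable_shift _) (measurableSet_cell p),
    shift_preimage_cell, sub_neg_eq_add]

end Configurations

/-! ### Koopman action of integer vectors. -/

section Action

variable {d : ℕ} {Q : Measure (Config d)}

/-- The action of integer vectors on `L¹` of an invariant law of configurations. -/
def action (hQ : ∀ v, MeasurePreserving (translate v) Q Q) (v : Fin d → ℤ) :
    Lp ℝ 1 Q →ₗᵢ[ℝ] Lp ℝ 1 Q :=
  koopman (translate v) (hQ v)

lemma coeFn_action (hQ : ∀ v, MeasurePreserving (translate v) Q Q) (v : Fin d → ℤ)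
    (x : Lp ℝ 1 Q) : action hQ v x =ᵐ[Q] fun y => x (translate v y) :=
  Lp.coeFn_compMeasurePreserving x (hQ v)

lemma isIsometricAction_action (hQ : ∀ v, MeasurePreserving (translate v) Q Q) :
    IsIsometricAction (action hQ) where
  zero x := by
    apply Lp.ext
    filter_upwards [coeFn_action hQ 0 x] with y h
    rw [h, translate_zero, id]
  add v w x := by
    apply Lp.ext
    filter_upwards [coeFn_action hQ (v + w) x, coeFn_action hQ v (action hQ w x),
      (hQ v).quasiMeasurePreserving.ae (coeFn_action hQ w x)] with y h1 h2 h3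
    rw [h1, h2, h3, translate_translate]

lemma exists_tendsto_avg_action [IsProbabilityMeasure Q]
    (hQ : ∀ v, MeasurePreserving (translate v) Q Q) (e : Fin d → ℤ) (x : Lp ℝ 1 Q) :
    ∃ L, Tendsto (fun n => IsIsometricAction.avg (action hQ) e n x) atTop (𝓝 L) := by
  obtain ⟨L, hL⟩ := exists_tendsto_birkhoffAverage_koopman (translate e) (hQ e) x
  refine ⟨L, hL.congr fun n => ?_⟩
  rw [birkhoffAverage, birkhoffSum, IsIsometricAction.avg]
  congr 1
  refine Finset.sum_congr rfl fun k hk => ?_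
  clear hk
  induction k with
  | zero => simp [(isIsometricAction_action hQ).zero]
  | succ k ih =>
    rw [succ_nsmul', (isIsometricAction_action hQ).add, ← ih]
    exact Function.iterate_succ_apply' _ _ _

end Action

/-! ### The red–blue discrepancy as a flow, and its size. -/

section Discrepancy

lemma nsmul_left_injective_of_ne_zero {d : ℕ} {e : Fin d → ℤ} (he : e ≠ 0) :
    Function.Injective fun k : ℕ => k • e := by
  obtain ⟨i, hi⟩ := Function.ne_iff.1 he
  intro a b hab
  have hi' : e i ≠ 0 := hi
  simpa [hi'] using congrFun hab i

variable {d : ℕ} {Ω : Type*} [MeasurableSpace Ω] {P : Measure Ω}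
  {R B : Ω → Measure (Space d)} {M : Ω → Measure (Sym2 (Space d))}

/-- The joint law of red points, blue points and edges. -/
def configLaw (R B : Ω → Measure (Space d)) (M : Ω → Measure (Sym2 (Space d)))
    (P : Measure Ω) : Measure (Config d) :=
  P.map fun ω => (R ω, B ω, M ω)

/-- A translation-invariant matching scheme between independent Poisson processes. -/
structure IsInvariantScheme (R B : Ω → Measure (Space d)) (M : Ω → Measure (Sym2 (Space d)))
    (P : Measure Ω) : Prop where
  red : IsPoissonProcess 1 R P
  blue : IsPoissonProcess 1 B P
  indep : IndepFun R B P
  edge : IsTwoColorMatchingScheme R B M P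
  invariant : IsTranslationInvariant R B M P
  pos : 0 < d

namespace IsInvariantScheme

lemma measurable_red (h : IsInvariantScheme R B M P) : Measurable R :=
  h.red.1.measurable

lemma measurable_blue (h : IsInvariantScheme R B M P) : Measurable B :=
  h.blue.1.measurable

lemma measurable_config (h : IsInvariantScheme R B M P) :
    Measurable fun ω => (R ω, B ω, M ω) :=
  h.measurable_red.prodMk (h.measurable_blue.prodMk h.edge.measurable)

lemma measurePreserving (h : IsInvariantScheme R B M P) (v : Fin d → ℤ) :
    MeasurePreserving (translate v) (configLaw R B M P) (configLaw R B M P) := by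
  refine ⟨measurable_translate v, ?_⟩
  rw [configLaw, Measure.map_map (measurable_translate v) h.measurable_config]
  exact (h.invariant (intVec (-v))).map_eq

lemma isProbabilityMeasure [IsProbabilityMeasure P] (h : IsInvariantScheme R B M P) :
    IsProbabilityMeasure (configLaw R B M P) :=
  Measure.isProbabilityMeasure_map h.measurable_config.aemeasurable

lemma lintegral_config (h : IsInvariantScheme R B M P) {f : Config d → ℝ≥0∞} (hf : Measurable f) :
    ∫⁻ y, f y ∂configLaw R B M P = ∫⁻ ω, f (R ω, B ω, M ω) ∂P :=
  lintegral_map hf h.measurable_config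

lemma ae_config (h : IsInvariantScheme R B M P) {f g : Config d → ℝ≥0∞} (hf : Measurable f)
    (hg : Measurable g) (hfg : ∀ᵐ ω ∂P, f (R ω, B ω, M ω) = g (R ω, B ω, M ω)) :
    ∀ᵐ y ∂configLaw R B M P, f y = g y :=
  (ae_map_iff h.measurable_config.aemeasurable (measurableSet_eq_fun hf hg)).2 hfg

lemma good [IsProbabilityMeasure P] (h : IsInvariantScheme R B M P) : ∀ᵐ ω ∂P, IsGood (R ω) (B ω) (M ω) :=
  ae_isGood h.pos h.red h.blue h.indep h.edge

/-- The class in `L¹` of the number of red points in a union of cells. -/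
def redCount (R B : Ω → Measure (Space d)) (M : Ω → Measure (Sym2 (Space d))) (P : Measure Ω)
    (A : Set (Space d)) : Lp ℝ 1 (configLaw R B M P) :=
  toL1 _ fun y => y.1 A

/-- The class in `L¹` of the number of blue points in a union of cells. -/
def blueCount (R B : Ω → Measure (Space d)) (M : Ω → Measure (Sym2 (Space d))) (P : Measure Ω)
    (A : Set (Space d)) : Lp ℝ 1 (configLaw R B M P) :=
  toL1 _ fun y => y.2.1 A

/-- The class in `L¹` of the number of edges from a red point in the cell `0` to the cell `v`. -/
def edgeCount (R B : Ω → Measure (Space d)) (M : Ω → Measure (Sym2 (Space d))) (P : Measure Ω)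
    (v : Fin d → ℤ) : Lp ℝ 1 (configLaw R B M P) :=
  toL1 _ (pairCount 0 v)

lemma measurable_fst_apply {A : Set (Space d)} (hA : MeasurableSet A) :
    Measurable fun y : Config d => y.1 A :=
  (Measure.measurable_coe hA).comp measurable_fst

lemma measurable_snd_apply {A : Set (Space d)} (hA : MeasurableSet A) :
    Measurable fun y : Config d => y.2.1 A :=
  (Measure.measurable_coe hA).comp (measurable_fst.comp measurable_snd)

lemma lintegral_red (h : IsInvariantScheme R B M P) {A : Set (Space d)} (hA : MeasurableSet A)
    (hb : Bornology.IsBounded A) : ∫⁻ y, y.1 A ∂configLaw R B M P = volume A := by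
  rw [h.lintegral_config (measurable_fst_apply hA), lintegral_count h.red hA hb]

lemma lintegral_blue (h : IsInvariantScheme R B M P) {A : Set (Space d)} (hA : MeasurableSet A)
    (hb : Bornology.IsBounded A) : ∫⁻ y, y.2.1 A ∂configLaw R B M P = volume A := by
  rw [h.lintegral_config (measurable_snd_apply hA), lintegral_count h.blue hA hb]

lemma red_ne_top (h : IsInvariantScheme R B M P) {A : Set (Space d)} (hA : MeasurableSet A)
    (hb : Bornology.IsBounded A) : ∫⁻ y, y.1 A ∂configLaw R B M P ≠ ∞ := by
  rw [h.lintegral_red hA hb]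
  exact hb.measure_lt_top.ne

lemma blue_ne_top (h : IsInvariantScheme R B M P) {A : Set (Space d)} (hA : MeasurableSet A)
    (hb : Bornology.IsBounded A) : ∫⁻ y, y.2.1 A ∂configLaw R B M P ≠ ∞ := by
  rw [h.lintegral_blue hA hb]
  exact hb.measure_lt_top.ne

lemma lintegral_pairCount (h : IsInvariantScheme R B M P) (v : Fin d → ℤ) :
    ∫⁻ y, pairCount 0 v y ∂configLaw R B M P = flow R M P v :=
  h.lintegral_config (measurable_pairCount 0 v)

lemma ae_tsum_pairCount_red [IsProbabilityMeasure P] (h : IsInvariantScheme R B M P) :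
    ∀ᵐ y ∂configLaw R B M P, ∑' v, pairCount 0 v y = y.1 (cell 0) := by
  refine h.ae_config (Measurable.tsum fun v => measurable_pairCount 0 v)
    (measurable_fst_apply (measurableSet_cell 0)) ?_
  filter_upwards [h.good] with ω hω
  exact (tsum_matchedPairs_snd _ _).trans (hω.matchedPairs_univ 0)

/-- After translation by `-v` the term counts edges from cube `-v` into cube `0`; summing over `v`
exhausts the blue points there. -/
lemma ae_tsum_pairCount_blue [IsProbabilityMeasure P] (h : IsInvariantScheme R B M P) :
    ∀ᵐ y ∂configLaw R B M P, ∑' v, pairCount 0 v (translate (-v) y) = y.2.1 (cell 0) := by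
  simp only [pairCount_translate, zero_add, add_neg_cancel]
  refine h.ae_config (Measurable.tsum fun v => measurable_pairCount (-v) 0)
    (measurable_snd_apply (measurableSet_cell 0)) ?_
  filter_upwards [h.good] with ω hω
  rw [← hω.tsum_matchedPairs 0]
  exact (Equiv.neg (Fin d → ℤ)).tsum_eq fun p => pairCount p 0 (R ω, B ω, M ω)

lemma flow_ne_top [IsProbabilityMeasure P] (h : IsInvariantScheme R B M P) (v : Fin d → ℤ) : flow R M P v ≠ ∞ := by
  have hr := h.red_ne_top (measurableSet_cell 0) (isBounded_cell 0)
  rw [← lintegral_congr_ae h.ae_tsum_pairCount_red,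
    lintegral_tsum fun v => (measurable_pairCount 0 v).aemeasurable] at hr
  rw [← h.lintegral_pairCount]
  exact ENNReal.ne_top_of_tsum_ne_top hr v

lemma norm_edgeCount [IsProbabilityMeasure P] (h : IsInvariantScheme R B M P) (v : Fin d → ℤ) :
    ‖edgeCount R B M P v‖ = (flow R M P v).toReal := by
  rw [edgeCount, norm_toL1 (measurable_pairCount 0 v), h.lintegral_pairCount]
  rw [h.lintegral_pairCount]
  exact h.flow_ne_top v

/-- The discrepancy of the unit cell is a superposition of displacements. -/
lemma hasSum_discrepancy [IsProbabilityMeasure P] (h : IsInvariantScheme R B M P) :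
    HasSum (fun v => edgeCount R B M P v -
      action h.measurePreserving (-v) (edgeCount R B M P v))
      (redCount R B M P (cell 0) - blueCount R B M P (cell 0)) := by
  have hb : ∀ v, action h.measurePreserving (-v) (edgeCount R B M P v) =
      toL1 _ fun y => pairCount 0 v (translate (-v) y) := fun v =>
    koopman_toL1 _ (h.measurePreserving (-v)) (measurable_pairCount 0 v) (by
      rw [h.lintegral_pairCount]
      exact h.flow_ne_top v)
  simp only [hb]
  refine (hasSum_toL1 _ _ (fun v => measurable_pairCount 0 v)
    (h.red_ne_top (measurableSet_cell 0) (isBounded_cell 0)) h.ae_tsum_pairCount_red).sub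
    (hasSum_toL1 _ _ (fun v => (measurable_pairCount 0 v).comp (measurable_translate (-v)))
    (h.blue_ne_top (measurableSet_cell 0) (isBounded_cell 0)) h.ae_tsum_pairCount_blue)

lemma sum_action_discrepancy (h : IsInvariantScheme R B M P) (S : Finset (Fin d → ℤ)) :
    ∑ p ∈ S, action h.measurePreserving p
      (redCount R B M P (cell 0) - blueCount R B M P (cell 0)) =
      redCount R B M P (cells S) - blueCount R B M P (cells S) := by
  have hr : ∀ p, action h.measurePreserving p (redCount R B M P (cell 0)) =
      toL1 _ fun y => y.1 (cell p) := fun p => by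
    rw [action, redCount, koopman_toL1 _ (h.measurePreserving p)
      (measurable_fst_apply (measurableSet_cell 0))
      (h.red_ne_top (measurableSet_cell 0) (isBounded_cell 0))]
    simp only [red_translate, zero_add]
  have hb : ∀ p, action h.measurePreserving p (blueCount R B M P (cell 0)) =
      toL1 _ fun y => y.2.1 (cell p) := fun p => by
    rw [action, blueCount, koopman_toL1 _ (h.measurePreserving p)
      (measurable_snd_apply (measurableSet_cell 0))
      (h.blue_ne_top (measurableSet_cell 0) (isBounded_cell 0))]
    simp only [blue_translate, zero_add]
  simp only [map_sub, Finset.sum_sub_distrib, hr, hb]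
  rw [← toL1_sum S _ (fun p => measurable_fst_apply (measurableSet_cell p))
      fun p => h.red_ne_top (measurableSet_cell p) (isBounded_cell p),
    ← toL1_sum S _ (fun p => measurable_snd_apply (measurableSet_cell p))
      fun p => h.blue_ne_top (measurableSet_cell p) (isBounded_cell p)]
  simp only [redCount, blueCount, measure_cells]

lemma norm_discrepancy (h : IsInvariantScheme R B M P) (S : Finset (Fin d → ℤ)) :
    ‖redCount R B M P (cells S) - blueCount R B M P (cells S)‖ =
      ∫ ω, |(R ω (cells S)).toReal - (B ω (cells S)).toReal| ∂P := by
  have hS := measurableSet_cells S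
  have hm : Measurable fun y : Config d => |(y.1 (cells S)).toReal - (y.2.1 (cells S)).toReal| :=
    ((measurable_fst_apply hS).ennreal_toReal.sub (measurable_snd_apply hS).ennreal_toReal).abs
  rw [redCount, blueCount, norm_toL1_sub (measurable_fst_apply hS)
    (h.red_ne_top hS (isBounded_cells S)) (measurable_snd_apply hS)
    (h.blue_ne_top hS (isBounded_cells S)), configLaw,
    integral_map h.measurable_config.aemeasurable hm.aestronglyMeasurable]

/-- The probabilistic input: Poisson counts in `S.card` cubes fluctuate exactly at order `√S.card`.
The lower bound gives the final contradiction, the upper one the vanishing of line averages. -/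
lemma norm_sum_action_bounds [IsProbabilityMeasure P] (h : IsInvariantScheme R B M P) (S : Finset (Fin d → ℤ))
    (hS : S.Nonempty) :
    √S.card * (1 - Real.exp (-(4 / Real.pi ^ 2))) ≤
        ‖∑ p ∈ S, action h.measurePreserving p
          (redCount R B M P (cell 0) - blueCount R B M P (cell 0))‖ ∧
      ‖∑ p ∈ S, action h.measurePreserving p
          (redCount R B M P (cell 0) - blueCount R B M P (cell 0))‖ ≤ 2 * √S.card := by
  have hm := measurableSet_cells S
  have hX : IsPoissonVar S.card (fun ω => (R ω (cells S)).toReal) P := by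
    simpa [volume_cells] using isPoissonVar_count h.red hm (isBounded_cells S)
  have hY : IsPoissonVar S.card (fun ω => (B ω (cells S)).toReal) P := by
    simpa [volume_cells] using isPoissonVar_count h.blue hm (isBounded_cells S)
  have hmX : Measurable fun ω => (R ω (cells S)).toReal :=
    ((Measure.measurable_coe hm).comp h.measurable_red).ennreal_toReal
  have hmY : Measurable fun ω => (B ω (cells S)).toReal :=
    ((Measure.measurable_coe hm).comp h.measurable_blue).ennreal_toReal
  have hc : Measurable fun m : Measure (Space d) => (m (cells S)).toReal :=
    (Measure.measurable_coe hm).ennreal_toReal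
  have hind : IndepFun (fun ω => (R ω (cells S)).toReal) (fun ω => (B ω (cells S)).toReal) P :=
    h.indep.comp hc hc
  have hcard : (1 : ℝ≥0) ≤ S.card := by exact_mod_cast hS.card_pos
  rw [h.sum_action_discrepancy, h.norm_discrepancy]
  constructor
  · simpa using IsPoissonVar.sqrt_mul_le_integral_abs_diff hmX hmY hX hY hind hcard
  · simpa using IsPoissonVar.integral_abs_diff_le hmX hmY hX hY (zero_lt_one.trans_le hcard)

lemma norm_sum_action_bounds_of_injective [IsProbabilityMeasure P] (h : IsInvariantScheme R B M P)
    {κ : Type*} {g : κ → Fin d → ℤ} (hg : Function.Injective g) (s : Finset κ) (hs : s.Nonempty) :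
    √s.card * (1 - Real.exp (-(4 / Real.pi ^ 2))) ≤
        ‖∑ k ∈ s, action h.measurePreserving (g k)
          (redCount R B M P (cell 0) - blueCount R B M P (cell 0))‖ ∧
      ‖∑ k ∈ s, action h.measurePreserving (g k)
          (redCount R B M P (cell 0) - blueCount R B M P (cell 0))‖ ≤ 2 * √s.card := by
  classical
  have hb := h.norm_sum_action_bounds (s.image g) (hs.image g)
  rwa [Finset.sum_image hg.injOn, Finset.card_image_of_injective _ hg] at hb

lemma summable_rpow_mul_norm_edgeCount [IsProbabilityMeasure P] (h : IsInvariantScheme R B M P) {s : ℝ} (hs0 : 0 ≤ s)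
    (hs1 : s ≤ 1) (hfin : ∫⁻ t, (t : ℝ≥0∞) ^ s ∂typicalDistance R M P ≠ ∞) (i : Fin d) :
    Summable fun v : Fin d → ℤ => |(v i : ℝ)| ^ s * ‖edgeCount R B M P v‖ := by
  have hprob := isProbabilityMeasure_typicalDistance (B := B) h.red h.edge.measurable h.good
  have hle := tsum_rpow_mul_flow_le (P := P) h.measurable_red h.edge.measurable hs0 hs1 i
  have hne : ∑' v : Fin d → ℤ, ‖(v i : ℝ)‖ₑ ^ s * flow R M P v ≠ ∞ := by
    refine ne_top_of_le_ne_top ?_ hle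
    rw [lintegral_add_right _ measurable_const]
    simpa using hfin
  refine (ENNReal.summable_toReal hne).congr fun v => ?_
  rw [ENNReal.toReal_mul, h.norm_edgeCount, ← ENNReal.toReal_rpow, toReal_enorm, Real.norm_eq_abs]

/-- Since `e ≠ 0`, the `n` translated cubes are distinct, so the sum has size `O(√n)` and the
average `O(1/√n)`. -/
lemma tendsto_avg_discrepancy [IsProbabilityMeasure P] (h : IsInvariantScheme R B M P) (e : Fin d → ℤ) (he : e ≠ 0) :
    Tendsto (fun n => IsIsometricAction.avg (action h.measurePreserving) e n
      (redCount R B M P (cell 0) - blueCount R B M P (cell 0))) atTop (𝓝 0) := by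
  have hlim : Tendsto (fun n : ℕ => 2 / √n) atTop (𝓝 0) :=
    tendsto_const_nhds.div_atTop (Real.tendsto_sqrt_atTop.comp tendsto_natCast_atTop_atTop)
  rw [tendsto_zero_iff_norm_tendsto_zero]
  refine squeeze_zero' (Eventually.of_forall fun n => norm_nonneg _) ?_ hlim
  filter_upwards [eventually_gt_atTop 0] with n hn
  have hb := (h.norm_sum_action_bounds_of_injective (nsmul_left_injective_of_ne_zero he)
    (Finset.range n) (by simpa using hn.ne')).2
  rw [Finset.card_range] at hb
  have hn' : (0 : ℝ) < n := by exact_mod_cast hn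
  rw [IsIsometricAction.avg, norm_smul, norm_inv, Real.norm_natCast]
  calc (n : ℝ)⁻¹ * _ ≤ (n : ℝ)⁻¹ * (2 * √n) := by gcongr
    _ = 2 / √n := by
      have hs : √(n : ℝ) * √n = n := Real.mul_self_sqrt hn'.le
      have hs0 : √(n : ℝ) ≠ 0 := (Real.sqrt_pos.2 hn').ne'
      nth_rw 1 [← hs]
      field_simp

end IsInvariantScheme

/-! ### The contradictions in dimensions one and two. -/

open IsInvariantScheme

/-- In dimension one the typical matching distance has infinite half moment. -/
theorem lintegral_sqrt_typicalDistance_eq_top [IsProbabilityMeasure P]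
    {R B : Ω → Measure (Space 1)} {M : Ω → Measure (Sym2 (Space 1))}
    (h : IsInvariantScheme R B M P) :
    ∫⁻ t, (t : ℝ≥0∞) ^ (1 / 2 : ℝ) ∂typicalDistance R M P = ∞ := by
  by_contra hfin
  have hT := isIsometricAction_action h.measurePreserving
  have hs := h.summable_rpow_mul_norm_edgeCount (by norm_num) (by norm_num) hfin 0
  have hneg : ∀ v : Fin 1 → ℤ, -v = (-v 0) • (1 : Fin 1 → ℤ) := fun v => by
    funext i
    simp [Subsingleton.elim i 0]
  have hD : HasSum (fun v => edgeCount R B M P v -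
      action h.measurePreserving ((-v 0) • (1 : Fin 1 → ℤ)) (edgeCount R B M P v))
      (redCount R B M P (cell 0) - blueCount R B M P (cell 0)) := by
    simp only [← hneg]
    exact h.hasSum_discrepancy
  have hs' : Summable fun v : Fin 1 → ℤ =>
      |((-v 0 : ℤ) : ℝ)| ^ (1 / 2 : ℝ) * ‖edgeCount R B M P v‖ := by
    simpa only [Int.cast_neg, abs_neg] using hs
  have hlim := hT.tendsto_sum_div_sqrt 1 (edgeCount R B M P) (fun v => -v 0) hs'
    (redCount R B M P (cell 0) - blueCount R B M P (cell 0)) hD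
  -- A sequence bounded below by this constant tends to zero, although the constant is positive.
  have hle : 1 - Real.exp (-(4 / Real.pi ^ 2)) ≤ 0 := by
    refine ge_of_tendsto hlim ?_
    filter_upwards [eventually_gt_atTop 0] with n hn
    have hb := (h.norm_sum_action_bounds_of_injective
      (nsmul_left_injective_of_ne_zero (one_ne_zero (α := Fin 1 → ℤ))) (Finset.range n)
      (by simpa using hn.ne')).1
    rw [Finset.card_range] at hb
    rwa [le_div_iff₀ (Real.sqrt_pos.2 (by exact_mod_cast hn)), mul_comm]
  exact one_sub_exp_neg_pos.not_ge hle

/-- In dimension two the typical matching distance has infinite mean. -/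
theorem lintegral_typicalDistance_eq_top [IsProbabilityMeasure P]
    {R B : Ω → Measure (Space 2)} {M : Ω → Measure (Sym2 (Space 2))}
    (h : IsInvariantScheme R B M P) :
    ∫⁻ t, (t : ℝ≥0∞) ^ (1 : ℝ) ∂typicalDistance R M P = ∞ := by
  by_contra hfin
  have hprob := h.isProbabilityMeasure
  have hT := isIsometricAction_action h.measurePreserving
  have hs : ∀ i, Summable fun v : Fin 2 → ℤ =>
      |((-v i : ℤ) : ℝ)| * ‖edgeCount R B M P v‖ := fun i => by
    simpa only [Int.cast_neg, abs_neg, Real.rpow_one] using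
      h.summable_rpow_mul_norm_edgeCount zero_le_one le_rfl hfin i
  have hneg : ∀ v : Fin 2 → ℤ, -v = (-v 0) • (![1, 0] : Fin 2 → ℤ) + (-v 1) • ![0, 1] :=
    fun v => by
      funext i
      fin_cases i <;> simp
  have hD : HasSum (fun v => edgeCount R B M P v - action h.measurePreserving
      ((-v 0) • (![1, 0] : Fin 2 → ℤ) + (-v 1) • ![0, 1]) (edgeCount R B M P v))
      (redCount R B M P (cell 0) - blueCount R B M P (cell 0)) := by
    simp only [← hneg]
    exact h.hasSum_discrepancy
  have he0 : (![1, 0] : Fin 2 → ℤ) ≠ 0 := fun h0 => by simpa using congrFun h0 0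
  have hf0 : (![0, 1] : Fin 2 → ℤ) ≠ 0 := fun h0 => by simpa using congrFun h0 1
  have hlim := (hT.tendsto_inv_smul_sum ![1, 0] ![0, 1]
    (exists_tendsto_avg_action h.measurePreserving _)
    (exists_tendsto_avg_action h.measurePreserving _) (edgeCount R B M P)
    (fun v => -v 0) (fun v => -v 1) (hs 0) (hs 1)
    (redCount R B M P (cell 0) - blueCount R B M P (cell 0)) hD
    (h.tendsto_avg_discrepancy _ he0) (h.tendsto_avg_discrepancy _ hf0)).norm
  rw [norm_zero] at hlim
  -- The square consists of `n²` distinct cubes, so the lower bound is of order `√(n²) = n`, the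
  -- normalisation of the flow bound.
  have hinj : Function.Injective fun k : ℕ × ℕ =>
      k.1 • (![1, 0] : Fin 2 → ℤ) + k.2 • ![0, 1] := fun a b hab => by
    have h0 := congrFun hab 0
    have h1 := congrFun hab 1
    simp at h0 h1
    exact Prod.ext h0 h1
  have hle : 1 - Real.exp (-(4 / Real.pi ^ 2)) ≤ 0 := by
    refine ge_of_tendsto hlim ?_
    filter_upwards [eventually_gt_atTop 0] with n hn
    have hn' : (0 : ℝ) < n := by exact_mod_cast hn
    have hb := (h.norm_sum_action_bounds_of_injective hinj (Finset.range n ×ˢ Finset.range n)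
      (by simpa using hn.ne')).1
    rw [Finset.card_product, Finset.card_range, Finset.sum_product, Nat.cast_mul,
      Real.sqrt_mul_self hn'.le] at hb
    simp only [hT.add] at hb
    rw [norm_smul, norm_inv, Real.norm_natCast, inv_mul_eq_div, le_div_iff₀ hn', mul_comm]
    exact hb
  exact one_sub_exp_neg_pos.not_ge hle

end Discrepancy

end PoissonMatching

end

theorem mainTheorem4 (d : ℕ) (hd : d = 1 ∨ d = 2)
    {Ω : Type*} [MeasurableSpace Ω] (P : Measure Ω) [IsProbabilityMeasure P]
    (R B : Ω → Measure (PoissonMatching.Space d))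
    (M : Ω → Measure (Sym2 (PoissonMatching.Space d)))
    (hR : PoissonMatching.IsPoissonProcess 1 R P)
    (hB : PoissonMatching.IsPoissonProcess 1 B P)
    (hRB : IndepFun R B P)
    (hM : PoissonMatching.IsTwoColorMatchingScheme R B M P)
    (hinv : PoissonMatching.IsTranslationInvariant R B M P) :
    (∃ ν : Measure ℝ≥0, IsProbabilityMeasure ν ∧
      ∀ r : ℝ≥0, ν (Set.Iic r) = PoissonMatching.matchingDistribution R M P r) ∧
    (∀ {Ω' : Type*} [MeasurableSpace Ω'] (P' : Measure Ω') [IsProbabilityMeasure P']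
      (X : Ω' → ℝ≥0), Measurable X →
      (∀ r : ℝ≥0, P' {ω | X ω ≤ r} = PoissonMatching.matchingDistribution R M P r) →
      ∫⁻ ω, (X ω : ℝ≥0∞) ^ ((d : ℝ) / 2) ∂P' = ∞) := by
  have hd0 : 0 < d := by omega
  have h : PoissonMatching.IsInvariantScheme R B M P := ⟨hR, hB, hRB, hM, hinv, hd0⟩
  have hcdf := PoissonMatching.typicalDistance_Iic h.measurable_red hM.measurable h.good
  have hprob := PoissonMatching.isProbabilityMeasure_typicalDistance hR hM.measurable h.good
  refine ⟨⟨_, hprob, hcdf⟩, ?_⟩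
  intro Ω' _ P' _ X hX hlaw
  -- A distribution function determines a probability law, so the moment need only be computed for
  -- `typicalDistance`.
  have hmap : P'.map X = PoissonMatching.typicalDistance R M P := by
    have : IsProbabilityMeasure (P'.map X) := Measure.isProbabilityMeasure_map hX.aemeasurable
    refine Measure.ext_of_Iic _ _ fun r => ?_
    rw [Measure.map_apply hX measurableSet_Iic, hcdf, ← hlaw r]
    rfl
  have hint : ∫⁻ ω, (X ω : ℝ≥0∞) ^ ((d : ℝ) / 2) ∂P' =
      ∫⁻ t, (t : ℝ≥0∞) ^ ((d : ℝ) / 2) ∂PoissonMatching.typicalDistance R M P := by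
    rw [← hmap, lintegral_map (by fun_prop) hX]
  rw [hint]
  rcases hd with rfl | rfl
  · rw [Nat.cast_one]
    exact PoissonMatching.lintegral_sqrt_typicalDistance_eq_top h
  · rw [Nat.cast_ofNat, div_self two_ne_zero]
    exact PoissonMatching.lintegral_typicalDistance_eq_top h
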